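/- Let $1\le k\le n$ be integers and let $\varphi$ be an arbitrary real-valued function on the set $\mathcal G(\mathbb R^n)$ of all linear subspaces of $\mathbb R^n$. Let $\mathcal P(\mathbb R^n)$ be the set of (non-empty) convex polytopes of $\mathbb R^n$, with Minkowski addition and multiplication by non-negative reals. For $\Gamma\in\mathcal P(\mathbb R^n)$ let $\mathcal B(\Gamma,k)$ be the set of its $k$-dimensional faces; for a face $\Delta$ of $\Gamma$ let $E_\Delta$ be the linear subspace parallel to the affine span of $\Delta$, let $h_\Gamma(v)=\max_{x\in\Gamma}(x,v)$, let $K_{\Delta,\Gamma}=\{v\in\mathbb R^n : \Delta=\{x\in\Gamma : (x,v)=h_\Gamma(v)\}\}\subseteq E_\Delta^\perp$ be the dual cone of $\Delta$ and, if $\dim\Delta=k$, let $\psi_\Gamma(\Delta)=\varkappa_{n-k}^{-1}\,\mathrm{vol}_{n-k}(K_{\Delta,\Gamma}\cap B_n)$ be its outer angle, where $B_n$ is the closed unit ball of $\mathbb R^n$ and $\varkappa_{\ell}$ is the volume of the unit ball of $\mathbb R^{\ell}$. The $k$-th intrinsic $\varphi$-volume of $\Gamma$ is $$v_k^\varphi(\Gamma)=\sum_{\Delta\in\mathcal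 B(\Gamma,k)}\varphi(E_\Delta)\,\mathrm{vol}_k(\Delta)\,\psi_\Gamma(\Delta),$$ and the $k$-th mixed $\varphi$-volume of $\Gamma_1,\dots,\Gamma_k\in\mathcal P(\mathbb R^n)$ is, with $\Gamma=\Gamma_1+\dots+\Gamma_k$, $$V_k^\varphi(\Gamma_1,\dots,\Gamma_k)=\sum_{\Delta\in\mathcal B(\Gamma,k)}\varphi(E_\Delta)\,V_k(\Delta_1,\dots,\Delta_k)\,\psi_\Gamma(\Delta),$$ where $\Delta_1,\dots,\Delta_k$ is the unique sequence of faces of $\Gamma_1,\dots,\Gamma_k$ with $\Delta=\Delta_1+\dots+\Delta_k$, and $V_k(\Delta_1,\dots,\Delta_k)$ is the $k$-dimensional Minkowski mixed volume of their projections on $E_\Delta\simeq\mathbb R^k$, i.e. $1/k!$ times the coefficient of $\lambda_1\cdots\lambda_k$ in the polynomial that gives, for $\lambda_1,\dots,\lambda_k\ge0$, the $k$-dimensional volume of the projection of $\sum_\ell\lambda_\ell\Delta_\ell$ on $E_\Delta$. Then: 1. (Polarization formula) for all $\Gamma_1,\dots,\Gamma_k\in\mathcal P(\mathbb R^n)$,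 $$V_k^\varphi(\Gamma_1,\dots,\Gamma_k)=\frac1{k!}\sum_{\varnothing\ne I\subseteq\{1,\dots,k\}}(-1)^{k-\#I}\,v_k^\varphi\Big(\sum_{\ell\in I}\Gamma_\ell\Big);$$ 2. $V_k^\varphi$ is symmetric in its $k$ arguments; 3. $V_k^\varphi$ is $k$-linear: in each argument, with the others fixed, $V_k^\varphi(\dots,\mu A+\mu'A',\dots)=\mu V_k^\varphi(\dots,A,\dots)+\mu'V_k^\varphi(\dots,A',\dots)$ for all $A,A'\in\mathcal P(\mathbb R^n)$ and all reals $\mu,\mu'\ge0$; 4. $V_k^\varphi(\Gamma,\dots,\Gamma)=v_k^\varphi(\Gamma)$ for every $\Gamma\in\mathcal P(\mathbb R^n)$, and $V_k^\varphi$ is the only symmetric $k$-linear function $\mathcal P(\mathbb R^n)^k\to\mathbb R$ with this property. -/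

import Mathlib

open scoped NNReal Pointwise

noncomputable section

namespace PhiVolume

/-- The Euclidean space `ℝⁿ`. -/
abbrev Euc (n : ℕ) : Type := EuclideanSpace ℝ (Fin n)

variable {n : ℕ}

/-! ## Polytopes and their faces -/

/-- The polytopes of `ℝⁿ`, i.e. the convex hulls of non-empty finite sets, inside Mathlib's
`ℝ≥0`-module of (non-empty) convex bodies, whose operations are the Minkowski sum
`A + B = {a + b}` (with neutral element `{0}`) and the multiplication `c • A = {c • a}`. -/
def polytopes (n : ℕ) : Submodule ℝ≥0 (ConvexBody (Euc n)) where
  carrier := {K | ∃ s : Set (Euc n), s.Finite ∧ (K : Set (Euc n)) = convexHull ℝ s}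
  add_mem' := by
    rintro K L ⟨s, hs, hK⟩ ⟨t, ht, hL⟩
    exact ⟨s + t, hs.add ht, by rw [ConvexBody.coe_add, hK, hL, convexHull_add]⟩
  zero_mem' := ⟨{0}, Set.finite_singleton 0, by simp [Set.singleton_zero]⟩
  smul_mem' := by
    rintro c K ⟨s, hs, hK⟩
    refine ⟨(c : ℝ) • s, hs.smul_set, ?_⟩
    rw [convexHull_smul, ← hK]
    rfl

/-- The type `𝒫(ℝⁿ)` of non-empty polytopes. -/
def Polytope (n : ℕ) : Type := polytopes n

instance : AddCommMonoid (Polytope n) := inferInstanceAs (AddCommMonoid (polytopes n))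

instance : Module ℝ≥0 (Polytope n) := inferInstanceAs (Module ℝ≥0 (polytopes n))

/-- The underlying point set of a polytope. -/
def Polytope.pts (Γ : Polytope n) : Set (Euc n) := ((Γ.1 : ConvexBody (Euc n)) : Set (Euc n))

theorem Polytope.ext {Γ Γ' : Polytope n} (h : Γ.pts = Γ'.pts) : Γ = Γ' :=
  Subtype.ext (ConvexBody.ext h)

theorem Polytope.pts_add (Γ Γ' : Polytope n) : (Γ + Γ').pts = Γ.pts + Γ'.pts := rfl

theorem Polytope.pts_smul (c : ℝ≥0) (Γ : Polytope n) : (c • Γ).pts = (c : ℝ) • Γ.pts := rfl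

theorem Polytope.pts_zero : (0 : Polytope n).pts = {0} := rfl

theorem Polytope.pts_sum {ι : Type*} (s : Finset ι) (Γ : ι → Polytope n) :
    (∑ ℓ ∈ s, Γ ℓ).pts = ∑ ℓ ∈ s, (Γ ℓ).pts := by
  classical
  induction s using Finset.induction_on with
  | empty => rfl
  | insert a s ha ih => rw [Finset.sum_insert ha, Finset.sum_insert ha, Polytope.pts_add, ih]

/-- `Δ` is a non-empty face of the convex set `Γ`. -/
structure IsFace (Γ Δ : Set (Euc n)) : Prop where
  isExtreme : IsExtreme ℝ Γ Δ
  convex : Convex ℝ Δ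
  nonempty : Δ.Nonempty

/-- `E_A`: the linear subspace parallel to the affine span of `A`. -/
abbrev dirSpace (A : Set (Euc n)) : Submodule ℝ (Euc n) := vectorSpan ℝ A

/-- `ℬ(Γ, k)`: the set of the `k`-dimensional non-empty faces of `Γ`. -/
def faces (Γ : Set (Euc n)) (k : ℕ) : Set (Set (Euc n)) :=
  {Δ | IsFace Γ Δ ∧ Module.finrank ℝ (dirSpace Δ) = k}

/-! ## Volumes and outer angles -/

/-- For a linear subspace `E` of dimension `d`, the `d`-dimensional Lebesgue measure of the
orthogonal projection on `E ≃ ℝᵈ` of the set `A`.  The measure on `E` is the Haar measure that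
gives mass `1` to the unit cubes.  If `A` lies in a translate of `E`, this is the
`d`-dimensional volume of `A`. -/
def volOn (E : Submodule ℝ (Euc n)) (A : Set (Euc n)) : ℝ :=
  ((stdOrthonormalBasis ℝ E).toBasis.addHaar).real (E.orthogonalProjectionOnto '' A)

/-- `ϰ_d`: the Lebesgue measure of the closed unit ball of `ℝᵈ`. -/
def ballVol (d : ℕ) : ℝ :=
  (MeasureTheory.volume : MeasureTheory.Measure (Euc d)).real (Metric.closedBall 0 1)

/-- The support function `h_A` of `A`. -/
def supportFun (A : Set (Euc n)) (v : Euc n) : ℝ :=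
  sSup ((fun x => inner ℝ v x) '' A)

/-- `H_A(v)`: the supporting hyperplane of `A` in the direction `v` (all of `ℝⁿ` if `v = 0`). -/
def supportHyp (A : Set (Euc n)) (v : Euc n) : Set (Euc n) :=
  {z | inner ℝ v z = supportFun A v}

/-- The dual cone `K_{Δ,Γ}` of the face `Δ` of `Γ`. -/
def dualCone (Γ Δ : Set (Euc n)) : Set (Euc n) :=
  {v | Δ = Γ ∩ supportHyp Γ v}

/-- The outer angle `ψ_Γ(Δ)` of the face `Δ` of `Γ`: the fraction of the unit ball of `E_Δᗮ`
(a space of dimension `n - dim Δ`) which is contained in the dual cone `K_{Δ,Γ} ⊆ E_Δᗮ`. -/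
def outerAngle (Γ Δ : Set (Euc n)) : ℝ :=
  (ballVol (Module.finrank ℝ (dirSpace Δ)ᗮ))⁻¹ *
    volOn (dirSpace Δ)ᗮ (dualCone Γ Δ ∩ Metric.closedBall 0 1)

/-! ## Mixed volumes -/

/-- `p` is the polynomial giving the volume (of the projections on `E`) of the
Minkowski combinations `∑ λ_ℓ A_ℓ` with `λ_ℓ ≥ 0`. -/
def IsVolPoly {k : ℕ} (E : Submodule ℝ (Euc n)) (A : Fin k → Set (Euc n))
    (p : MvPolynomial (Fin k) ℝ) : Prop :=
  ∀ t : Fin k → ℝ, (∀ ℓ, 0 ≤ t ℓ) → volOn E (∑ ℓ, t ℓ • A ℓ) = MvPolynomial.eval t p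

open Classical in
/-- The `k`-dimensional Minkowski mixed volume `V_k(A_1, …, A_k)` of the projections of
`A_1, …, A_k` on the `k`-dimensional subspace `E ≃ ℝᵏ`: if
`vol_k(∑ λ_ℓ A_ℓ) = ∑_ρ V_k(A_{ρ(1)}, …, A_{ρ(k)}) λ_{ρ(1)} ⋯ λ_{ρ(k)}`, where `ρ` runs through all
the functions `{1,…,k} → {1,…,k}` and the coefficients are symmetric, it is the coefficient with
`ρ = id`.  The monomial `λ_1 ⋯ λ_k` arises from the `k!` permutations `ρ`, so it is `1/k!` times
the coefficient of that monomial. -/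
def mixedVolume {k : ℕ} (E : Submodule ℝ (Euc n)) (A : Fin k → Set (Euc n)) : ℝ :=
  if h : ∃ p, IsVolPoly E A p then
    MvPolynomial.coeff (Finsupp.equivFunOnFinite.symm fun _ => 1) h.choose / (k.factorial : ℝ)
  else 0

/-- The volume polynomial is unique, so that the mixed volume does not depend on the choice. -/
theorem IsVolPoly.unique {k : ℕ} {E : Submodule ℝ (Euc n)} {A : Fin k → Set (Euc n)}
    {p q : MvPolynomial (Fin k) ℝ} (hp : IsVolPoly E A p) (hq : IsVolPoly E A q) : p = q := by
  refine MvPolynomial.funext_set (fun _ => Set.Ici (0 : ℝ)) (fun _ => Set.Ici_infinite 0) ?_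
  intro t ht
  have ht' : ∀ ℓ, 0 ≤ t ℓ := fun ℓ => ht ℓ (Set.mem_univ ℓ)
  rw [← hp t ht', ← hq t ht']

theorem mixedVolume_eq {k : ℕ} {E : Submodule ℝ (Euc n)} {A : Fin k → Set (Euc n)}
    {p : MvPolynomial (Fin k) ℝ} (hp : IsVolPoly E A p) :
    mixedVolume E A =
      MvPolynomial.coeff (Finsupp.equivFunOnFinite.symm fun _ => 1) p / (k.factorial : ℝ) := by
  have h : ∃ p, IsVolPoly E A p := ⟨p, hp⟩
  rw [mixedVolume, dif_pos h, IsVolPoly.unique h.choose_spec hp]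

/-! ## The faces of a polytope are finitely many polytopes -/

theorem IsFace.eq_convexHull {s Δ : Set (Euc n)} (h : IsFace (convexHull ℝ s) Δ) :
    Δ = convexHull ℝ (s ∩ Δ) := by
  apply Set.Subset.antisymm _ (convexHull_min Set.inter_subset_right h.convex)
  intro x hx
  have hd : convexHull ℝ (s \ Δ) ⊆ convexHull ℝ s \ Δ :=
    convexHull_min (fun y hy => ⟨subset_convexHull ℝ s hy.1, hy.2⟩)
      (h.isExtreme.convex_sdiff (convex_convexHull ℝ s))
  have hxs := h.isExtreme.subset hx
  rcases (s ∩ Δ).eq_empty_or_nonempty with h1 | h1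
  · have : s \ Δ = s := by
      rw [← Set.sdiff_inter_self_eq_sdiff, Set.inter_comm, h1, Set.sdiff_empty]
    rw [this] at hd
    exact absurd hx (hd hxs).2
  rcases (s \ Δ).eq_empty_or_nonempty with h2 | h2
  · rwa [Set.inter_eq_left.2 (Set.sdiff_eq_empty.1 h2)]
  rw [← Set.inter_union_sdiff s Δ, convexHull_union h1 h2, mem_convexJoin] at hxs
  obtain ⟨a, ha, b, hb, hab⟩ := hxs
  have ha' : a ∈ convexHull ℝ s := convexHull_mono Set.inter_subset_left ha
  rw [← insert_endpoints_openSegment] at hab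
  rcases hab with rfl | rfl | hab
  · exact ha
  · exact absurd hx (hd hb).2
  · exact absurd (h.isExtreme.right_mem_of_mem_openSegment ha' (hd hb).1 hx hab) (hd hb).2

theorem Polytope.exists_pts_eq (Γ : Polytope n) :
    ∃ s : Set (Euc n), s.Finite ∧ Γ.pts = convexHull ℝ s := Γ.2

theorem IsFace.isCompact {Γ : Polytope n} {Δ : Set (Euc n)} (h : IsFace Γ.pts Δ) :
    IsCompact Δ := by
  obtain ⟨s, hs, hΓ⟩ := Γ.exists_pts_eq
  rw [hΓ] at h
  rw [h.eq_convexHull]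
  exact (hs.inter_of_left Δ).isCompact_convexHull ℝ

theorem finite_faces (Γ : Polytope n) (k : ℕ) : (faces Γ.pts k).Finite := by
  obtain ⟨s, hs, hΓ⟩ := Γ.exists_pts_eq
  refine (hs.finite_subsets.image (convexHull ℝ)).subset ?_
  rintro Δ ⟨h, -⟩
  rw [hΓ] at h
  exact ⟨s ∩ Δ, Set.inter_subset_left, h.eq_convexHull.symm⟩

/-! ## The Minkowski summands of a face of a Minkowski sum -/

/-- The `ℓ`-th Minkowski summand `Δ_ℓ` of the face `Δ` of `∑ Γ_j`: the set of the `ℓ`-th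
components of all the decompositions `∑ x_j ∈ Δ` with `x_j ∈ Γ_j`. -/
def summand {k : ℕ} (Γ : Fin k → Set (Euc n)) (Δ : Set (Euc n)) (ℓ : Fin k) : Set (Euc n) :=
  {v | ∃ x : Fin k → Euc n, (∀ j, x j ∈ Γ j) ∧ ∑ j, x j ∈ Δ ∧ x ℓ = v}

theorem sum_update {k : ℕ} (x : Fin k → Euc n) (ℓ : Fin k) (u : Euc n) :
    ∑ j, Function.update x ℓ u j = (∑ j, x j) - x ℓ + u := by
  rw [Finset.sum_update_of_mem (Finset.mem_univ ℓ),
    ← Finset.add_sum_erase Finset.univ x (Finset.mem_univ ℓ), Finset.sdiff_singleton_eq_erase]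
  abel

theorem update_mem {k : ℕ} {Γ : Fin k → Set (Euc n)} {x : Fin k → Euc n} (hx : ∀ j, x j ∈ Γ j)
    {ℓ : Fin k} {u : Euc n} (hu : u ∈ Γ ℓ) (j : Fin k) : Function.update x ℓ u j ∈ Γ j := by
  rcases eq_or_ne j ℓ with rfl | hj
  · simpa using hu
  · simpa [hj] using hx j

theorem summand_isFace {k : ℕ} {Γ : Fin k → Set (Euc n)} (hΓ : ∀ ℓ, Convex ℝ (Γ ℓ))
    {Δ : Set (Euc n)} (h : IsFace (∑ ℓ, Γ ℓ) Δ) (ℓ : Fin k) :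
    IsFace (Γ ℓ) (summand Γ Δ ℓ) := by
  refine ⟨⟨?_, ?_⟩, ?_, ?_⟩
  · rintro v ⟨x, hx, -, rfl⟩
    exact hx ℓ
  · rintro u hu v hv w ⟨x, hx, hxΔ, rfl⟩ ⟨a, b, ha, hb, hab, hw⟩
    refine ⟨Function.update x ℓ u, update_mem hx hu, ?_, by simp⟩
    refine h.isExtreme.left_mem_of_mem_openSegment
      (Set.mem_fintype_sum _ _ |>.2 ⟨_, update_mem hx hu, rfl⟩)
      (Set.mem_fintype_sum _ _ |>.2 ⟨_, update_mem hx hv, rfl⟩) hxΔ ⟨a, b, ha, hb, hab, ?_⟩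
    rw [sum_update, sum_update]
    have : a • ((∑ j, x j) - x ℓ + u) + b • ((∑ j, x j) - x ℓ + v)
        = (a + b) • ((∑ j, x j) - x ℓ) + (a • u + b • v) := by module
    rw [this, hab, hw]
    module
  · rintro u ⟨x, hx, hxΔ, rfl⟩ v ⟨y, hy, hyΔ, rfl⟩ a b ha hb hab
    refine ⟨a • x + b • y, fun j => hΓ j (hx j) (hy j) ha hb hab, ?_, rfl⟩
    have := h.convex hxΔ hyΔ ha hb hab
    simpa [Finset.sum_add_distrib, Finset.smul_sum] using this
  · obtain ⟨z, hz⟩ := h.nonempty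
    obtain ⟨x, hx, rfl⟩ := (Set.mem_fintype_sum _ _).1 (h.isExtreme.subset hz)
    exact ⟨x ℓ, x, hx, hz, rfl⟩

theorem sum_summand {k : ℕ} {Γ : Fin k → Set (Euc n)} {Δ : Set (Euc n)}
    (h : IsFace (∑ ℓ, Γ ℓ) Δ) : ∑ ℓ, summand Γ Δ ℓ = Δ := by
  apply Set.Subset.antisymm
  · intro z hz
    obtain ⟨y, hy, rfl⟩ := (Set.mem_fintype_sum _ _).1 hz
    choose x hx hxΔ hxy using hy
    have hyΓ : ∀ j, y j ∈ Γ j := fun j => hxy j ▸ hx j j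
    obtain ⟨w, hw⟩ := h.nonempty
    obtain ⟨g, hg, rfl⟩ := (Set.mem_fintype_sum _ _).1 (h.isExtreme.subset hw)
    have key : ∀ s : Finset (Fin k), ∃ f : Fin k → Euc n, (∀ j, f j ∈ Γ j) ∧ ∑ j, f j ∈ Δ ∧
        ∀ j ∈ s, f j = y j := by
      intro s
      induction s using Finset.induction_on with
      | empty => exact ⟨g, hg, hw, by simp⟩
      | insert ℓ s hℓ ih =>
        obtain ⟨f, hf, hfΔ, hfy⟩ := ih
        refine ⟨Function.update f ℓ (y ℓ), update_mem hf (hyΓ ℓ), ?_, ?_⟩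
        · have hm := h.convex hfΔ (hxΔ ℓ) (by norm_num : (0 : ℝ) ≤ 1 / 2)
            (by norm_num : (0 : ℝ) ≤ 1 / 2) (by norm_num)
          refine h.isExtreme.left_mem_of_mem_openSegment
            (Set.mem_fintype_sum _ _ |>.2 ⟨_, update_mem hf (hyΓ ℓ), rfl⟩)
            (Set.mem_fintype_sum _ _ |>.2 ⟨_, update_mem (hx ℓ) (hf ℓ), rfl⟩) hm
            ⟨1 / 2, 1 / 2, by norm_num, by norm_num, by norm_num, ?_⟩
          rw [sum_update, sum_update, hxy ℓ]
          module
        · intro j hj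
          rcases eq_or_ne j ℓ with rfl | hne
          · simp
          · rw [Function.update_of_ne hne]
            exact hfy j (Finset.mem_of_mem_insert_of_ne hj hne)
    obtain ⟨f, -, hfΔ, hfy⟩ := key Finset.univ
    rwa [Finset.sum_congr rfl fun j _ => hfy j (Finset.mem_univ j)] at hfΔ
  · intro z hz
    obtain ⟨x, hx, rfl⟩ := (Set.mem_fintype_sum _ _).1 (h.isExtreme.subset hz)
    exact (Set.mem_fintype_sum _ _).2 ⟨x, fun ℓ => ⟨x, hx, hz, rfl⟩, rfl⟩

/-- The summands of a face `Δ` of a Minkowski sum `∑ Γ_ℓ` of polytopes are the unique sequence of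
faces `Δ_ℓ` of `Γ_ℓ` for which `Δ = ∑ Δ_ℓ`. -/
theorem summand_unique {k : ℕ} {Γ : Fin k → Polytope n} {Δ : Set (Euc n)}
    (h : IsFace (∑ ℓ, (Γ ℓ).pts) Δ) {F : Fin k → Set (Euc n)}
    (hF : ∀ ℓ, IsFace (Γ ℓ).pts (F ℓ)) (hsum : ∑ ℓ, F ℓ = Δ) :
    F = summand (fun ℓ => (Γ ℓ).pts) Δ := by
  have hsub : ∀ ℓ, F ℓ ⊆ summand (fun ℓ => (Γ ℓ).pts) Δ ℓ := by
    intro ℓ v hv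
    choose g hg using fun j => (hF j).nonempty
    refine ⟨Function.update g ℓ v,
      fun j => (hF j).isExtreme.subset (update_mem hg hv j), ?_, by simp⟩
    rw [← hsum]
    exact (Set.mem_fintype_sum _ _).2 ⟨_, update_mem hg hv, rfl⟩
  funext ℓ
  apply Set.Subset.antisymm (hsub ℓ)
  intro v hv
  by_contra hvF
  obtain ⟨f, u, hfu, huv⟩ :=
    geometric_hahn_banach_closed_point (hF ℓ).convex (hF ℓ).isCompact.isClosed hvF
  choose m hm hmax using fun j =>
    (hF j).isCompact.exists_isMaxOn (hF j).nonempty f.continuous.continuousOn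
  have hmem : ∑ j, Function.update m ℓ v j ∈ ∑ j, F j := by
    rw [hsum, ← sum_summand h]
    exact (Set.mem_fintype_sum _ _).2 ⟨_, update_mem (fun j => hsub j (hm j)) hv, rfl⟩
  obtain ⟨g, hg, hgs⟩ := (Set.mem_fintype_sum _ _).1 hmem
  have hlt : ∑ j, f (g j) < ∑ j, f (Function.update m ℓ v j) := by
    refine Finset.sum_lt_sum (fun j _ => ?_) ⟨ℓ, Finset.mem_univ ℓ, ?_⟩
    · rcases eq_or_ne j ℓ with rfl | hj
      · simpa using ((hfu _ (hg j)).trans huv).le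
      · simpa [hj] using hmax j (hg j)
    · simpa using (hfu _ (hg ℓ)).trans huv
  rw [← map_sum, ← map_sum, hgs] at hlt
  exact lt_irrefl _ hlt

/-! ## Intrinsic and mixed `φ`-volumes

The function `φ` is an arbitrary real function on the Grassmannian of all the linear subspaces of
`ℝⁿ`. -/

/-- The `k`-th intrinsic `φ`-volume
`v_k^φ(Γ) = ∑_{Δ ∈ ℬ(Γ,k)} φ(E_Δ) vol_k(Δ) ψ_Γ(Δ)`. -/
def intrinsicVol (φ : Submodule ℝ (Euc n) → ℝ) (k : ℕ) (Γ : Polytope n) : ℝ :=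
  ∑ Δ ∈ (finite_faces Γ k).toFinset,
    φ (dirSpace Δ) * volOn (dirSpace Δ) Δ * outerAngle Γ.pts Δ

/-- The `k`-th mixed `φ`-volume
`V_k^φ(Γ_1, …, Γ_k) = ∑_{Δ ∈ ℬ(Γ,k)} φ(E_Δ) V_k(Δ_1, …, Δ_k) ψ_Γ(Δ)`, with `Γ = ∑ Γ_ℓ`. -/
def mixedVol (φ : Submodule ℝ (Euc n) → ℝ) {k : ℕ} (Γ : Fin k → Polytope n) : ℝ :=
  ∑ Δ ∈ (finite_faces (∑ ℓ, Γ ℓ) k).toFinset,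
    φ (dirSpace Δ) * mixedVolume (dirSpace Δ) (summand (fun ℓ => (Γ ℓ).pts) Δ) *
      outerAngle (∑ ℓ, Γ ℓ).pts Δ

/-- Symmetry of a function of `k` polytopes. -/
def IsSymmetric {k : ℕ} (L : (Fin k → Polytope n) → ℝ) : Prop :=
  ∀ (σ : Equiv.Perm (Fin k)) (Γ : Fin k → Polytope n), L (fun ℓ => Γ (σ ℓ)) = L Γ

/-- `k`-linearity of a function of `k` polytopes, with respect to the Minkowski sum and the
multiplication by non-negative real numbers. -/
def IsKLinear {k : ℕ} (L : (Fin k → Polytope n) → ℝ) : Prop :=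
  ∀ (Γ : Fin k → Polytope n) (ℓ : Fin k) (a b : ℝ≥0) (A B : Polytope n),
    L (Function.update Γ ℓ (a • A + b • B)) =
      a * L (Function.update Γ ℓ A) + b * L (Function.update Γ ℓ B)

end PhiVolume

end

open scoped NNReal Pointwise

noncomputable section

namespace PhiVolume

/-! ## The Euler relation for compact convex sets -/

/-! Fix a `k`-dimensional subspace `E`. Each `w` in `Eᗮ` selects one exposed face of `Γ`, and
passing to that face respects Minkowski combinations (`faceMap`). Integrate the `E`-volume of the
selected face over the unit ball of `Eᗮ`: a face with direction space `E` contributes its volume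
times its outer angle, up to the volume of the ball; a face with strictly smaller direction space
has no `E`-volume; any other face is selected only by a null set of `w`. So both φ-volumes are
finite sums over `E` of φ(E) times such integrals (`sum_faces_eq_sum_integral`), the integrand of
the mixed one being the Minkowski mixed volume of the selected faces. Since φ is only a weight
attached to `E`, polarization, linearity and the diagonal formula are inherited from ordinary mixed
volumes pointwise in `w`, and symmetry follows from polarization. Uniqueness is algebra: a symmetric
multilinear function is an alternating sum of its diagonal values (`altSum_diagonal`).

Ordinary mixed volumes rest on the polynomiality of the volume of Minkowski combinations. If `P` is
the hull of a_1, …, a_N, then ∏ ([P] - [a_i]) = 0, where indicators are multiplied through Minkowski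
sums; this reduces to the Euler relation `sum_ite_nonempty_eq_zero` in the space of barycentric
coordinates. Integration kills the N-th difference of vol(Q + jtP) in `j`
(`fwdDiff_iter_measureReal_eq_zero`); monotonicity extends the resulting polynomial to real
dilations, and interpolation extends it to several variables. -/

open Classical in
theorem sum_ite_nonempty_eq_zero_of_real {ι : Type*} (s : Finset ι) (c : ι → ℝ) (J : ι → Set ℝ)
    (hJ : ∀ i, IsCompact (J i)) (hJc : ∀ i, Convex ℝ (J i))
    (h : ∀ x, ∑ i ∈ s, (if x ∈ J i then c i else 0) = 0) :
    ∑ i ∈ s, (if (J i).Nonempty then c i else 0) = 0 := by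
  -- Subtract the relation at a point just to the right of `b` from the relation at `b`: only the
  -- intervals whose right endpoint is `b` survive. Summing over all right endpoints gives the
  -- claim.
  have key : ∀ b : ℝ, ∑ i ∈ s with (J i).Nonempty, (if sSup (J i) = b then c i else 0) = 0 := by
    intro b
    have hev : ∀ i, ∀ᶠ x in nhdsWithin b (Set.Ioi b),
        (if b ∈ J i then c i else 0) - (if x ∈ J i then c i else 0) =
          if (J i).Nonempty then (if sSup (J i) = b then c i else 0) else 0 := by
      intro i
      by_cases hne : (J i).Nonempty
      · have hI : J i = Set.Icc (sInf (J i)) (sSup (J i)) :=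
          eq_Icc_of_connected_compact ⟨hne, (hJc i).isPreconnected⟩ (hJ i)
        have hle : sInf (J i) ≤ sSup (J i) := by
          rw [hI] at hne
          exact Set.nonempty_Icc.1 hne
        rw [if_pos hne]
        generalize sInf (J i) = l at *
        generalize sSup (J i) = u at *
        rw [hI]
        rcases lt_or_ge b l with h1 | h1
        · filter_upwards [nhdsWithin_le_nhds (Iio_mem_nhds h1)] with x hx
          have hx' : x < l := hx
          rw [if_neg (fun hh => h1.not_ge hh.1), if_neg (fun hh => hx'.not_ge hh.1),
            if_neg (fun hh => by linarith), sub_zero]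
        · rcases lt_or_ge b u with h2 | h2
          · filter_upwards [nhdsWithin_le_nhds (Iio_mem_nhds h2), self_mem_nhdsWithin]
              with x hx hx'
            have hx1 : x < u := hx
            have hx2 : b < x := hx'
            rw [if_pos ⟨h1, h2.le⟩, if_pos ⟨by linarith, hx1.le⟩, if_neg h2.ne', sub_self]
          · filter_upwards [self_mem_nhdsWithin] with x hx'
            have hx2 : b < x := hx'
            rw [if_neg (fun hh : x ∈ Set.Icc l u => by linarith [hh.2]), sub_zero]
            congr 1
            exact propext ⟨fun hh => le_antisymm h2 hh.2, fun hh => ⟨h1, hh.ge⟩⟩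
      · rw [Set.not_nonempty_iff_eq_empty] at hne
        simp [hne]
    obtain ⟨x, hx⟩ := ((Filter.eventually_all_finset s).2 fun i _ => hev i).exists
    rw [Finset.sum_filter, ← Finset.sum_congr rfl hx, Finset.sum_sub_distrib, h, h, sub_zero]
  rw [← Finset.sum_filter, ← Finset.sum_fiberwise_of_maps_to (g := fun i => sSup (J i))
    (t := (s.filter fun i => (J i).Nonempty).image fun i => sSup (J i))
    (fun i hi => Finset.mem_image_of_mem _ hi)]
  refine Finset.sum_eq_zero fun b _ => ?_
  rw [Finset.sum_filter, key]

open Classical in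
/-- The Euler characteristic is well defined: a linear relation between the indicator functions of
compact convex sets is a relation between the indicators of their being non-empty. -/
theorem sum_ite_nonempty_eq_zero {ι : Type*} (s : Finset ι) (c : ι → ℝ) (d : ℕ)
    (Y : ι → Set (Fin d → ℝ)) (hY : ∀ i, IsCompact (Y i)) (hYc : ∀ i, Convex ℝ (Y i))
    (h : ∀ x, ∑ i ∈ s, (if x ∈ Y i then c i else 0) = 0) :
    ∑ i ∈ s, (if (Y i).Nonempty then c i else 0) = 0 := by
  induction d with
  | zero =>
    refine (Finset.sum_congr rfl fun i _ => ?_).trans (h 0)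
    congr 1
    exact propext ⟨fun ⟨y, hy⟩ => Subsingleton.elim y 0 ▸ hy, fun hy => ⟨_, hy⟩⟩
  | succ d ih =>
    have hcons : ∀ (t : ℝ), Continuous fun y : Fin d → ℝ => (Fin.cons t y : Fin (d + 1) → ℝ) := by
      intro t
      refine continuous_pi fun j => ?_
      refine Fin.cases ?_ (fun j => ?_) j
      · simpa using continuous_const
      · simpa using continuous_apply j
    have htail : Continuous fun y : Fin (d + 1) → ℝ => (Fin.tail y : Fin d → ℝ) :=
      continuous_pi fun j => continuous_apply j.succ
    -- The induction hypothesis on the slices at first coordinate `t` is a relation between the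
    -- indicators of the projections to the first coordinate, which the one-dimensional case then
    -- handles.
    have hslice : ∀ t : ℝ,
        ∑ i ∈ s, (if t ∈ (fun y : Fin (d + 1) → ℝ => y 0) '' Y i then c i else 0) = 0 := by
      intro t
      have := ih (fun i => (fun y : Fin d → ℝ => (Fin.cons t y : Fin (d + 1) → ℝ)) ⁻¹' Y i)
        (fun i => ?_) (fun i => ?_) (fun x => h (Fin.cons t x))
      · rw [← this]
        refine Finset.sum_congr rfl fun i _ => ?_
        congr 1
        refine propext ⟨?_, ?_⟩
        · rintro ⟨y, hy, rfl⟩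
          exact ⟨Fin.tail y, by simpa using hy⟩
        · rintro ⟨y, hy⟩
          exact ⟨_, hy, by simp⟩
      · refine ((hY i).image htail).of_isClosed_subset ((hY i).isClosed.preimage (hcons t)) ?_
        intro y hy
        exact ⟨_, hy, by simp⟩
      · intro y hy z hz a b ha hb hab
        have := hYc i hy hz ha hb hab
        simp only [Set.mem_preimage]
        convert this using 1
        ext j
        refine Fin.cases ?_ (fun j => ?_) j
        · simp [← add_mul, hab]
        · simp
    have := sum_ite_nonempty_eq_zero_of_real s c (fun i => (fun y : Fin (d + 1) → ℝ => y 0) '' Y i)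
      (fun i => (hY i).image (continuous_apply 0))
      (fun i => (hYc i).linear_image (LinearMap.proj (R := ℝ) (φ := fun _ : Fin (d + 1) => ℝ) 0))
      hslice
    simpa only [Set.image_nonempty] using this

/-! ### Vertex relation between the Minkowski combinations of a polytope -/

theorem smul_convexHull_range_eq {E : Type*} [AddCommGroup E] [Module ℝ E] {N : ℕ} (hN : 0 < N)
    (a : Fin N → E) {T : ℝ} (hT : 0 ≤ T) :
    T • convexHull ℝ (Set.range a) =
      {x | ∃ l : Fin N → ℝ, (∀ j, 0 ≤ l j) ∧ ∑ j, l j = T ∧ ∑ j, l j • a j = x} := by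
  have hc : convexHull ℝ (Set.range a) =
      {x | ∃ l : Fin N → ℝ, (∀ j, 0 ≤ l j) ∧ ∑ j, l j = 1 ∧ ∑ j, l j • a j = x} := by
    rw [convexHull_range_eq_exists_affineCombination]
    ext x
    constructor
    · rintro ⟨s, w, hw, hs, rfl⟩
      refine ⟨fun j => if j ∈ s then w j else 0, fun j => ?_, by simpa using hs, ?_⟩
      · dsimp only
        split_ifs with hj
        exacts [hw j hj, le_rfl]
      · rw [Finset.affineCombination_eq_linear_combination _ _ _ hs]
        simp [ite_smul]
    · rintro ⟨l, hl, hs, rfl⟩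
      exact ⟨Finset.univ, l, fun j _ => hl j, hs,
        Finset.affineCombination_eq_linear_combination _ _ _ hs⟩
  rw [hc]
  ext x
  constructor
  · rintro ⟨_, ⟨l, hl, hs, rfl⟩, rfl⟩
    refine ⟨fun j => T * l j, fun j => mul_nonneg hT (hl j), ?_, ?_⟩
    · rw [← Finset.mul_sum, hs, mul_one]
    · simp [Finset.smul_sum, mul_smul]
  · rintro ⟨l, hl, hs, rfl⟩
    rcases hT.eq_or_lt with rfl | hT'
    -- Only here is `0 < N` needed: for `N = 0` and `T = 0` the left side is empty while the right
    -- side is {0}. The value `T = 0` does occur later, for the full index set.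
    · have hl0 : ∀ j, l j = 0 := fun j =>
        (Finset.sum_eq_zero_iff_of_nonneg fun j _ => hl j).1 hs j (Finset.mem_univ j)
      refine ⟨a ⟨0, hN⟩, ⟨Pi.single ⟨0, hN⟩ 1, fun j => ?_, by simp, ?_⟩, by simp [hl0]⟩
      · by_cases hj : j = ⟨0, hN⟩
        · subst hj; simp
        · simp [hj]
      · simp [Pi.single_apply, ite_smul]
    · refine ⟨_, ⟨fun j => T⁻¹ * l j, fun j => mul_nonneg (inv_nonneg.2 hT) (hl j), ?_, rfl⟩, ?_⟩
      · rw [← Finset.mul_sum, hs, inv_mul_cancel₀ hT'.ne']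
      · simp [Finset.smul_sum, smul_smul, mul_inv_cancel_left₀ hT'.ne']

open Classical in
/-- The product over the vertices `a_i` of the differences `[P] - [a_i]` vanishes,
where `P` is the convex hull of the `a_i`. -/
theorem sum_neg_one_pow_card_mem_add_eq_zero {E : Type*} [NormedAddCommGroup E] [NormedSpace ℝ E]
    {N : ℕ} (hN : 0 < N) (a : Fin N → E) {Q : Set E} (hQ : IsClosed Q) (hQc : Convex ℝ Q) (x : E) :
    ∑ I : Finset (Fin N), (if x ∈ Q + ((N : ℝ) - I.card) • convexHull ℝ (Set.range a) +
      {∑ i ∈ I, a i} then (-1 : ℝ) ^ I.card else 0) = 0 := by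
  -- `K` collects the ways of writing `x` as a point of `Q` plus a combination of the `a j` of total
  -- mass `N`. Removing one unit of mass at each index of `I` shows that `x` lies in the `I`-th set
  -- exactly when `Y I` is non-empty, so the Euler relation for the `Y I` applies.
  set K : Set (Fin N → ℝ) :=
    {l | (∀ j, 0 ≤ l j) ∧ ∑ j, l j = N ∧ x - ∑ j, l j • a j ∈ Q} with hK
  set Y : Finset (Fin N) → Set (Fin N → ℝ) := fun I => {l | l ∈ K ∧ ∀ i ∈ I, 1 ≤ l i} with hYdef
  have hKclosed : IsClosed K := by
    refine IsClosed.inter ?_ (IsClosed.inter ?_ ?_)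
    · have : {l : Fin N → ℝ | ∀ j, 0 ≤ l j} = ⋂ j, {l | 0 ≤ l j} := by ext; simp
      change IsClosed {l : Fin N → ℝ | ∀ j, 0 ≤ l j}
      rw [this]
      exact isClosed_iInter fun j => isClosed_le continuous_const (continuous_apply j)
    · exact isClosed_eq (by fun_prop) continuous_const
    · exact hQ.preimage (f := fun l : Fin N → ℝ => x - ∑ j, l j • a j) (by fun_prop)
  have hKcompact : IsCompact K := by
    refine (isCompact_univ_pi (fun _ : Fin N => isCompact_Icc (a := (0 : ℝ)) (b := N))).of_isClosed_subset
      hKclosed ?_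
    rintro l ⟨h0, h1, -⟩ j -
    exact ⟨h0 j, h1 ▸ Finset.single_le_sum (fun j _ => h0 j) (Finset.mem_univ j)⟩
  have hKconv : Convex ℝ K := by
    rintro l ⟨h0, h1, h2⟩ m ⟨g0, g1, g2⟩ p q hp hq hpq
    refine ⟨fun j => ?_, ?_, ?_⟩
    · exact add_nonneg (mul_nonneg hp (h0 j)) (mul_nonneg hq (g0 j))
    · simp only [Pi.add_apply, Pi.smul_apply, smul_eq_mul, Finset.sum_add_distrib,
        ← Finset.mul_sum, h1, g1, ← add_mul, hpq, one_mul]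
    · have := hQc h2 g2 hp hq hpq
      convert this using 1
      simp only [Pi.add_apply, Pi.smul_apply, smul_eq_mul, add_smul, Finset.sum_add_distrib,
        mul_smul, ← Finset.smul_sum]
      rw [smul_sub, smul_sub, sub_add_sub_comm, ← add_smul, hpq, one_smul]
  have hYclosed : ∀ I : Finset (Fin N), IsClosed {l : Fin N → ℝ | ∀ i ∈ I, 1 ≤ l i} := by
    intro I
    have : {l : Fin N → ℝ | ∀ i ∈ I, 1 ≤ l i} = ⋂ i ∈ I, {l | 1 ≤ l i} := by ext; simp
    rw [this]
    exact isClosed_iInter fun i => isClosed_iInter fun _ =>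
      isClosed_le continuous_const (continuous_apply i)
  have hmem : ∀ I, (x ∈ Q + ((N : ℝ) - I.card) • convexHull ℝ (Set.range a) +
      {∑ i ∈ I, a i}) ↔ (Y I).Nonempty := by
    intro I
    have hcard : (0 : ℝ) ≤ (N : ℝ) - I.card := by
      have := I.card_le_univ
      rw [Fintype.card_fin] at this
      have : (I.card : ℝ) ≤ N := by exact_mod_cast this
      linarith
    have hind : ∑ j, (if j ∈ I then (1 : ℝ) else 0) = I.card := by simp
    have hind2 : ∑ j, (if j ∈ I then (1 : ℝ) else 0) • a j = ∑ i ∈ I, a i := by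
      simp [ite_smul]
    rw [smul_convexHull_range_eq hN a hcard]
    constructor
    · rintro ⟨_, ⟨q, hq, _, ⟨l, h0, h1, rfl⟩, rfl⟩, _, rfl, hx⟩
      refine ⟨fun j => l j + if j ∈ I then 1 else 0, ⟨fun j => ?_, ?_, ?_⟩, fun i hi => ?_⟩
      · have := h0 j
        positivity
      · rw [Finset.sum_add_distrib, h1, hind]
        ring
      · simp only [add_smul, Finset.sum_add_distrib]
        rw [hind2]
        convert hq using 1
        rw [← hx]
        dsimp only
        abel
      · simp [hi, h0 i]
    · rintro ⟨l, ⟨h0, h1, h2⟩, h3⟩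
      refine ⟨_, ⟨_, h2, _, ⟨fun j => l j - if j ∈ I then 1 else 0, fun j => ?_, ?_, rfl⟩, rfl⟩, _,
        rfl, ?_⟩
      · dsimp only
        split_ifs with hj
        · linarith [h3 j hj]
        · simpa using h0 j
      · rw [Finset.sum_sub_distrib, h1, hind]
      · simp only [sub_smul, Finset.sum_sub_distrib]
        rw [hind2]
        abel
  simp only [hmem]
  have hYcompact : ∀ I, IsCompact (Y I) := fun I => hKcompact.inter_right (hYclosed I)
  have hYconv : ∀ I, Convex ℝ (Y I) := by
    refine fun I => hKconv.inter ?_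
    intro l hl m hm p q hp hq hpq i hi
    have h1 := mul_le_mul_of_nonneg_left (hl i hi) hp
    have h2 := mul_le_mul_of_nonneg_left (hm i hi) hq
    simp only [Pi.add_apply, Pi.smul_apply, smul_eq_mul]
    linarith
  have hYmem : ∀ I l, l ∈ Y I ↔ l ∈ K ∧ ∀ i ∈ I, 1 ≤ l i := fun _ _ => Iff.rfl
  have hKsum : ∀ l ∈ K, ∑ j, l j = N := fun l hl => hl.2.1
  clear_value Y K
  refine sum_ite_nonempty_eq_zero Finset.univ (fun I : Finset (Fin N) => (-1 : ℝ) ^ I.card) N Y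
    hYcompact hYconv fun l => ?_
  by_cases hl : l ∈ K
  · have hne : (Finset.univ.filter fun i => 1 ≤ l i).Nonempty := by
      by_contra hne
      rw [Finset.not_nonempty_iff_eq_empty, Finset.filter_eq_empty_iff] at hne
      have : ∑ j, l j < ∑ j : Fin N, (1 : ℝ) :=
        Finset.sum_lt_sum_of_nonempty ⟨⟨0, hN⟩, Finset.mem_univ _⟩
          fun j hj => not_le.1 (hne hj)
      rw [hKsum l hl] at this
      simp at this
    have hz := Finset.sum_powerset_neg_one_pow_card_of_nonempty hne
    have hz' : ∑ I ∈ (Finset.univ.filter fun i => 1 ≤ l i).powerset, (-1 : ℝ) ^ I.card = 0 := by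
      exact_mod_cast hz
    rw [← Finset.sum_filter, ← hz']
    refine Finset.sum_congr ?_ fun _ _ => rfl
    ext I
    simp [hYmem, hl, Finset.subset_iff]
  · exact Finset.sum_eq_zero fun I _ => if_neg fun hh => hl ((hYmem I l).1 hh).1

/-! ## Volumes of Minkowski combinations are polynomials -/

/-- Newton's forward difference formula. Its natural range `m + 1` may be replaced by `N`, because
binomials vanish beyond `m` and differences vanish from order `N` on. -/
theorem exists_polynomial_of_fwdDiff_iter_eq_zero {N : ℕ} {g : ℕ → ℝ}
    (h : ∀ m, (fwdDiff 1)^[N] g m = 0) :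
    ∃ p : Polynomial ℝ, p.degree < N ∧ ∀ m : ℕ, g m = p.eval (m : ℝ) := by
  refine ⟨∑ k ∈ Finset.range N,
    Polynomial.C ((fwdDiff 1)^[k] g 0 / k.factorial) * descPochhammer ℝ k, ?_, fun m => ?_⟩
  · refine (Polynomial.degree_sum_le _ _).trans_lt
      ((Finset.sup_lt_iff (WithBot.bot_lt_coe N)).2 fun k hk => ?_)
    refine Polynomial.degree_le_natDegree.trans_lt ?_
    refine WithBot.coe_lt_coe.2 ((Polynomial.natDegree_C_mul_le _ _).trans_lt ?_)
    rw [descPochhammer_natDegree]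
    exact Finset.mem_range.1 hk
  · have hz : ∀ k, N ≤ k → (fwdDiff 1)^[k] g 0 = 0 := by
      intro k hk
      obtain ⟨d, rfl⟩ := Nat.exists_eq_add_of_le' hk
      have : (fwdDiff 1)^[N] g = fun _ => (0 : ℝ) := funext h
      rw [Function.iterate_add_apply, this]
      clear this hk
      induction d with
      | zero => rfl
      | succ d ih => rw [Function.iterate_succ_apply, fwdDiff_const, ih]
    have h1 := shift_eq_sum_fwdDiff_iter (1 : ℕ) g m 0
    simp only [zero_add, smul_eq_mul, mul_one] at h1
    rw [h1, Polynomial.eval_finsetSum]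
    have hterm : ∀ k, (Polynomial.C ((fwdDiff 1)^[k] g 0 / k.factorial) *
        descPochhammer ℝ k).eval (m : ℝ) = m.choose k • (fwdDiff 1)^[k] g 0 := by
      intro k
      rw [Polynomial.eval_mul, Polynomial.eval_C, descPochhammer_eval_eq_descFactorial,
        Nat.descFactorial_eq_factorial_mul_choose, nsmul_eq_mul]
      have : (k.factorial : ℝ) ≠ 0 := by exact_mod_cast k.factorial_ne_zero
      push_cast
      field_simp
    simp only [hterm]
    rcases le_total (m + 1) N with hmN | hmN
    · refine Finset.sum_subset (Finset.range_subset_range.2 hmN) fun k _ hk => ?_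
      rw [Finset.mem_range, not_lt] at hk
      rw [Nat.choose_eq_zero_of_lt hk, zero_smul]
    · symm
      refine Finset.sum_subset (Finset.range_subset_range.2 hmN) fun k _ hk => ?_
      rw [Finset.mem_range, not_lt] at hk
      rw [hz k hk, smul_zero]

/-- The polynomials found on the lattices (1/d)ℕ all agree with the one found on ℕ, since ℕ lies in
each of them. This settles the rationals, and monotonicity squeezes the real values in between. -/
theorem exists_polynomial_of_monotoneOn {N : ℕ} {f : ℝ → ℝ} (hf : MonotoneOn f (Set.Ici 0))
    (h : ∀ t : ℝ, 0 < t → ∀ m : ℕ, (fwdDiff 1)^[N] (fun j : ℕ => f (j * t)) m = 0) :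
    ∃ p : Polynomial ℝ, p.degree < N ∧ ∀ s, 0 ≤ s → f s = p.eval s := by
  obtain ⟨p, hp, hfp⟩ := exists_polynomial_of_fwdDiff_iter_eq_zero (h 1 one_pos)
  simp only [mul_one] at hfp
  have hrat : ∀ q : ℚ, 0 ≤ q → f q = p.eval (q : ℝ) := by
    intro q hq
    have hden : (q.den : ℝ) ≠ 0 := by exact_mod_cast q.den_ne_zero
    have hden0 : (0 : ℝ) < q.den := by exact_mod_cast q.den_pos
    obtain ⟨r, -, hfr⟩ := exists_polynomial_of_fwdDiff_iter_eq_zero (h _ (inv_pos.2 hden0))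
    have hpr : p = r.comp (Polynomial.C (q.den : ℝ) * Polynomial.X) := by
      refine Polynomial.eq_of_infinite_eval_eq _ _ ((Set.infinite_range_of_injective
        (Nat.cast_injective (R := ℝ))).mono ?_)
      rintro _ ⟨j, rfl⟩
      have := hfr (q.den * j)
      push_cast at this
      simp only [Set.mem_ofPred_eq, Polynomial.eval_comp, Polynomial.eval_mul, Polynomial.eval_C,
        Polynomial.eval_X]
      rw [← hfp, ← this, mul_comm (q.den : ℝ), mul_assoc, mul_inv_cancel₀ hden, mul_one]
    have hq' : (q : ℝ) = (q.num.toNat : ℝ) * (q.den : ℝ)⁻¹ := by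
      have h1 : ((q.num.toNat : ℤ) : ℝ) = (q.num : ℝ) := by
        rw [Int.toNat_of_nonneg (Rat.num_nonneg.2 hq)]
      rw [Int.cast_natCast] at h1
      rw [h1, ← div_eq_mul_inv]
      exact Rat.cast_def q
    rw [hq', hfr, hpr]
    simp only [Polynomial.eval_comp, Polynomial.eval_mul, Polynomial.eval_C, Polynomial.eval_X]
    congr 1
    field_simp
  refine ⟨p, hp, fun s hs => ?_⟩
  have hcont : Continuous fun x => p.eval x := p.continuous
  apply le_antisymm
  · refine le_of_forall_gt_imp_ge_of_dense fun c hc => ?_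
    have hev : ∀ᶠ x in nhds s, p.eval x < c := hcont.continuousAt.eventually_lt_const hc
    obtain ⟨ε, hε, hball⟩ := Metric.eventually_nhds_iff.1 hev
    obtain ⟨q, hq1, hq2⟩ := exists_rat_btwn (show s < s + ε by linarith)
    have hq0 : (0 : ℝ) ≤ q := hs.trans hq1.le
    have := hball (y := q) (by rw [Real.dist_eq, abs_lt]; constructor <;> linarith)
    rw [← hrat q (by exact_mod_cast hq0)] at this
    exact (hf hs hq0 hq1.le).trans this.le
  -- At 0 there is no smaller non-negative rational to approximate from, but 0 is itself rational.
  · rcases hs.eq_or_lt with rfl | hs'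
    · have := hrat 0 le_rfl
      rw [Rat.cast_zero] at this
      exact this.ge
    refine le_of_forall_lt_imp_le_of_dense fun c hc => ?_
    have hev : ∀ᶠ x in nhds s, c < p.eval x := hcont.continuousAt.eventually_const_lt hc
    obtain ⟨ε, hε, hball⟩ := Metric.eventually_nhds_iff.1 hev
    obtain ⟨q, hq1, hq2⟩ := exists_rat_btwn (show max 0 (s - ε) < s from max_lt hs' (by linarith))
    have hq0 : (0 : ℝ) ≤ q := (le_max_left _ _).trans hq1.le
    have hq3 : s - ε < q := (le_max_right _ _).trans_lt hq1
    have := hball (y := q) (by rw [Real.dist_eq, abs_lt]; constructor <;> linarith)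
    rw [← hrat q (by exact_mod_cast hq0)] at this
    exact this.le.trans (hf hq0 hs hq2.le)

/-! ### The volume of a convex body plus a dilated polytope -/

section Minkowski

open MeasureTheory

theorem measureReal_add_singleton {E : Type*} [NormedAddCommGroup E] [MeasurableSpace E]
    [BorelSpace E] (μ : Measure E) [μ.IsAddHaarMeasure] (S : Set E) (v : E) :
    μ.real (S + {v}) = μ.real S := by
  rw [Set.add_singleton, Set.image_add_right, Measure.real, measure_preimage_add_right,
    Measure.real]

theorem isCompact_convexHull_range {E : Type*} [NormedAddCommGroup E] [NormedSpace ℝ E] {N : ℕ}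
    (a : Fin N → E) : IsCompact (convexHull ℝ (Set.range a)) :=
  (Set.finite_range a).isCompact_convexHull ℝ

variable {E : Type*} [NormedAddCommGroup E] [NormedSpace ℝ E]
  [MeasurableSpace E] [BorelSpace E] (μ : Measure E) [μ.IsAddHaarMeasure]

open Classical in
-- Integrate the indicator relation; the translations by partial sums of the vertices do not affect
-- the measure.
theorem sum_neg_one_pow_card_measureReal_eq_zero {N : ℕ} (hN : 0 < N) (a : Fin N → E) {Q : Set E}
    (hQ : IsCompact Q) (hQc : Convex ℝ Q) :
    ∑ I : Finset (Fin N), (-1 : ℝ) ^ I.card *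
      μ.real (Q + ((N : ℝ) - I.card) • convexHull ℝ (Set.range a)) = 0 := by
  set X : Finset (Fin N) → Set E := fun I =>
    Q + ((N : ℝ) - I.card) • convexHull ℝ (Set.range a) + {∑ i ∈ I, a i} with hX
  have hXc : ∀ I, IsCompact (X I) := fun I =>
    (hQ.add ((isCompact_convexHull_range a).smul _)).add isCompact_singleton
  have hint : ∀ I, Integrable ((X I).indicator fun _ => (-1 : ℝ) ^ I.card) μ := fun I =>
    (integrable_indicator_iff (hXc I).measurableSet).2
      (integrableOn_const (hXc I).measure_lt_top.ne)
  have h0 : ∫ x, ∑ I, (X I).indicator (fun _ => (-1 : ℝ) ^ I.card) x ∂μ = 0 := by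
    rw [← integral_zero E ℝ (μ := μ)]
    congr 1
    ext x
    have := sum_neg_one_pow_card_mem_add_eq_zero hN a hQ.isClosed hQc x
    simpa only [Set.indicator_apply] using this
  rw [integral_finsetSum _ fun I _ => hint I] at h0
  rw [← h0]
  refine Finset.sum_congr rfl fun I _ => ?_
  rw [integral_indicator_const _ (hXc I).measurableSet, hX, measureReal_add_singleton, smul_eq_mul,
    mul_comm]

/-- The vertex relation for the points `t • a i` and the body Q + mtP, with the subsets grouped by
cardinality: the binomials that appear are those of the N-th difference, read backwards. -/
theorem fwdDiff_iter_measureReal_eq_zero {N : ℕ} (hN : 0 < N) (a : Fin N → E) {Q : Set E}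
    (hQ : IsCompact Q) (hQc : Convex ℝ Q) {t : ℝ} (ht : 0 ≤ t) (m : ℕ) :
    (fwdDiff 1)^[N] (fun j : ℕ => μ.real (Q + ((j : ℝ) * t) • convexHull ℝ (Set.range a))) m
      = 0 := by
  set P := convexHull ℝ (Set.range a) with hP
  have hPc : Convex ℝ P := convex_convexHull ℝ _
  have h1 := sum_neg_one_pow_card_measureReal_eq_zero μ hN (fun i => t • a i)
    (hQ.add ((isCompact_convexHull_range a).smul (m * t))) (hQc.add (hPc.smul (m * t)))
  have hr : convexHull ℝ (Set.range fun i => t • a i) = t • P := by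
    rw [hP, ← convexHull_smul, Set.range_smul]
  rw [hr, ← Finset.powerset_univ, Finset.sum_powerset_apply_card (fun j : ℕ =>
    (-1 : ℝ) ^ j * μ.real (Q + (m * t) • P + ((N : ℝ) - j) • t • P)), Finset.card_univ,
    Fintype.card_fin, ← Finset.sum_flip] at h1
  rw [fwdDiff_iter_eq_sum_shift, ← h1]
  refine Finset.sum_congr rfl fun j hj => ?_
  have hj' : j ≤ N := Nat.lt_succ_iff.1 (Finset.mem_range.1 hj)
  have hset : Q + ((m + j • 1 : ℕ) * t : ℝ) • P =
      Q + (m * t) • P + ((N : ℝ) - (N - j : ℕ)) • t • P := by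
    rw [smul_smul, add_assoc, ← hPc.add_smul (by positivity)]
    · congr 2
      push_cast [hj']
      simp only [smul_eq_mul, mul_one]
      ring
    · push_cast [hj']
      have : (0 : ℝ) ≤ j := by positivity
      nlinarith
  rw [hset, Nat.choose_symm hj', nsmul_eq_mul, zsmul_eq_mul]
  push_cast
  ring

/-- The volume of `Q + s P` is a polynomial in `s ≥ 0` if `P` is a polytope. -/
theorem exists_polynomial_measureReal_add_smul {N : ℕ} (hN : 0 < N) (a : Fin N → E) {Q : Set E}
    (hQ : IsCompact Q) (hQc : Convex ℝ Q) :
    ∃ p : Polynomial ℝ, p.degree < N ∧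
      ∀ s, 0 ≤ s → μ.real (Q + s • convexHull ℝ (Set.range a)) = p.eval s := by
  set P := convexHull ℝ (Set.range a) with hP
  have hPc : Convex ℝ P := convex_convexHull ℝ _
  have hPk : IsCompact P := isCompact_convexHull_range a
  refine exists_polynomial_of_monotoneOn ?_
    fun t ht m => fwdDiff_iter_measureReal_eq_zero μ hN a hQ hQc ht.le m
  intro s hs t ht hst
  dsimp only
  have hs' : (0 : ℝ) ≤ s := hs
  have hp : a ⟨0, hN⟩ ∈ P := subset_convexHull ℝ _ ⟨_, rfl⟩
  -- `P` need not contain 0, so `Q + s • P` must be translated by `(t - s)` times a vertex before it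
  -- fits into `Q + t • P`.
  rw [← measureReal_add_singleton μ (Q + s • P) ((t - s) • a ⟨0, hN⟩)]
  refine measureReal_mono ?_ (hQ.add (hPk.smul t)).measure_lt_top.ne
  rw [add_assoc]
  refine Set.add_subset_add_left ?_
  have : t • P = s • P + (t - s) • P := by
    rw [← hPc.add_smul hs' (sub_nonneg.2 hst)]
    congr 1
    ring
  rw [this]
  exact Set.add_subset_add_left (Set.singleton_subset_iff.2 (Set.smul_mem_smul_set hp))

end Minkowski

/-! ## Polarization of homogeneous polynomial functions -/

section Polarization

variable {M : Type*} [AddCommMonoid M] [Module ℝ≥0 M]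

/-- `f` restricts to a homogeneous polynomial of degree `k` on all the finitely generated cones. -/
def IsHomogeneousPoly (k : ℕ) (f : M → ℝ) : Prop :=
  ∀ (ι : Type) [Fintype ι] (A : ι → M), ∃ p : MvPolynomial ι ℝ, p.IsHomogeneous k ∧
    ∀ t : ι → ℝ≥0, f (∑ i, t i • A i) = MvPolynomial.eval (fun i => (t i : ℝ)) p

/-- The degree bound `N` depends on `A` but not on `Q`, so one variable can be interpolated at the
fixed nodes 0, …, N-1. The values at the nodes are polynomials in the other variables by induction,
with the node absorbed into `Q`. -/
theorem exists_mvPolynomial_of_polynomial {f : M → ℝ}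
    (h : ∀ A : M, ∃ N : ℕ, ∀ Q : M, ∃ p : Polynomial ℝ, p.degree < N ∧
      ∀ s : ℝ≥0, f (Q + s • A) = p.eval (s : ℝ))
    {ι : Type} (A : ι → M) (S : Finset ι) (Q : M) :
    ∃ p : MvPolynomial ι ℝ, ∀ t : ι → ℝ≥0,
      f (Q + ∑ i ∈ S, t i • A i) = MvPolynomial.eval (fun i => (t i : ℝ)) p := by
  classical
  induction S using Finset.induction_on generalizing Q with
  | empty => exact ⟨MvPolynomial.C (f Q), fun t => by simp⟩
  | insert a S ha ih =>
    obtain ⟨N, hN⟩ := h (A a)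
    choose p hp using ih
    refine ⟨∑ j ∈ Finset.range N, p (Q + (j : ℝ≥0) • A a) *
      Polynomial.aeval (MvPolynomial.X a)
        (Lagrange.basis (Finset.range N) (fun j : ℕ => (j : ℝ)) j), fun t => ?_⟩
    obtain ⟨q, hqd, hq⟩ := hN (Q + ∑ i ∈ S, t i • A i)
    have hinj : Set.InjOn (fun j : ℕ => (j : ℝ)) (Finset.range N : Set ℕ) :=
      Nat.cast_injective.injOn
    have hqi := Lagrange.eq_interpolate (s := Finset.range N) (v := fun j : ℕ => (j : ℝ)) (f := q)
      hinj (by rwa [Finset.card_range])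
    rw [Finset.sum_insert ha, add_left_comm, add_comm, hq, hqi, Lagrange.interpolate_apply,
      Polynomial.eval_finsetSum, map_sum]
    refine Finset.sum_congr rfl fun j _ => ?_
    rw [Polynomial.eval_mul, Polynomial.eval_C, map_mul, ← hp, add_right_comm]
    congr 1
    · have := hq j
      rw [NNReal.coe_natCast] at this
      exact this.symm
    · rw [← MvPolynomial.coe_aeval_eq_eval, RingHom.coe_coe, ← Polynomial.aeval_algHom_apply,
        MvPolynomial.aeval_X, Polynomial.coe_aeval_eq_eval]

/-- Along the ray through `t` both sides of the scaling law are polynomials in `c` that agree for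
all `c ≥ 0`; compare the coefficients of degree `k`. -/
theorem eval_homogeneousComponent_of_smul {ι : Type} {k : ℕ} {p : MvPolynomial ι ℝ} {t : ι → ℝ}
    (h : ∀ c : ℝ, 0 ≤ c → MvPolynomial.eval (c • t) p = c ^ k * MvPolynomial.eval t p) :
    MvPolynomial.eval t (MvPolynomial.homogeneousComponent k p) = MvPolynomial.eval t p := by
  have heval : ∀ (c : ℝ) (j : ℕ),
      MvPolynomial.eval (c • t) (MvPolynomial.homogeneousComponent j p) =
        c ^ j * MvPolynomial.eval t (MvPolynomial.homogeneousComponent j p) := by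
    intro c j
    have hj := MvPolynomial.homogeneousComponent_isHomogeneous j p
    rw [MvPolynomial.eval_eq, MvPolynomial.eval_eq, Finset.mul_sum]
    refine Finset.sum_congr rfl fun d hd => ?_
    have hdeg : d.degree = j := by
      rw [Finsupp.degree_eq_weight_one]
      exact hj (MvPolynomial.mem_support_iff.1 hd)
    have : ∏ i ∈ d.support, (c • t) i ^ d i = c ^ j * ∏ i ∈ d.support, t i ^ d i := by
      simp only [Pi.smul_apply, smul_eq_mul, mul_pow, Finset.prod_mul_distrib]
      rw [Finset.prod_pow_eq_pow_sum, ← hdeg, Finsupp.degree_apply]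
    rw [this]
    ring
  have hpoly : ∑ j ∈ Finset.range (p.totalDegree + 1), Polynomial.C
        (MvPolynomial.eval t (MvPolynomial.homogeneousComponent j p)) * Polynomial.X ^ j =
      Polynomial.C (MvPolynomial.eval t p) * Polynomial.X ^ k := by
    refine Polynomial.eq_of_infinite_eval_eq _ _ ((Set.Ici_infinite (0 : ℝ)).mono fun c hc => ?_)
    have hc' : (0 : ℝ) ≤ c := hc
    simp only [Set.mem_ofPred_eq, Polynomial.eval_finsetSum, Polynomial.eval_mul,
      Polynomial.eval_C, Polynomial.eval_pow, Polynomial.eval_X]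
    rw [mul_comm _ (c ^ k), ← h c hc']
    conv_rhs => rw [← MvPolynomial.sum_homogeneousComponent p, map_sum]
    exact Finset.sum_congr rfl fun j _ => by rw [heval, mul_comm]
  have hk := congrArg (fun q => Polynomial.coeff q k) hpoly
  simp only [Polynomial.finsetSum_coeff, Polynomial.coeff_C_mul_X_pow, if_true,
    Finset.sum_ite_eq] at hk
  split_ifs at hk with hmem
  · exact hk
  · rw [← hk, MvPolynomial.homogeneousComponent_eq_zero _ _ (by simpa using hmem), map_zero]

theorem IsHomogeneousPoly.of_polynomial {k : ℕ} {f : M → ℝ}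
    (h : ∀ A : M, ∃ N : ℕ, ∀ Q : M, ∃ p : Polynomial ℝ, p.degree < N ∧
      ∀ s : ℝ≥0, f (Q + s • A) = p.eval (s : ℝ))
    (hf : ∀ (c : ℝ≥0) (A : M), f (c • A) = (c : ℝ) ^ k * f A) : IsHomogeneousPoly k f := by
  intro ι _ A
  obtain ⟨p, hp⟩ := exists_mvPolynomial_of_polynomial h A Finset.univ 0
  simp only [zero_add] at hp
  refine ⟨_, MvPolynomial.homogeneousComponent_isHomogeneous k p, fun t => ?_⟩
  rw [eval_homogeneousComponent_of_smul, hp]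
  intro c hc
  lift c to ℝ≥0 using hc
  have := hp (c • t)
  simp only [Pi.smul_apply, smul_eq_mul, NNReal.coe_mul, mul_smul, ← Finset.smul_sum] at this
  rw [hf, hp] at this
  rw [this]
  rfl

/-! ### Alternating sums as inclusion–exclusion over the variables -/

theorem sum_neg_one_pow_ite_subset {ι : Type*} [Fintype ι] [DecidableEq ι] (J : Finset ι) (c : ℝ) :
    ∑ I : Finset ι, (-1 : ℝ) ^ (Fintype.card ι - I.card) * (if J ⊆ I then c else 0) =
      if J = Finset.univ then c else 0 := by
  have h : ∑ I : Finset ι, (-1 : ℝ) ^ (Fintype.card ι - I.card) * (if J ⊆ I then c else 0) =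
      ∑ I : Finset ι, if I ∈ Jᶜ.powerset then (-1 : ℝ) ^ I.card * c else 0 := by
    refine Fintype.sum_equiv (Function.Involutive.toPerm compl compl_involutive) _ _ fun I => ?_
    simp [Finset.card_compl]
  have hz := Finset.sum_powerset_neg_one_pow_card (x := Jᶜ)
  have hz' : ∑ I ∈ Jᶜ.powerset, (-1 : ℝ) ^ I.card = if Jᶜ = ∅ then 1 else 0 := by exact_mod_cast hz
  rw [h, Finset.sum_ite_mem, Finset.univ_inter, ← Finset.sum_mul, hz']
  simp

open Classical in
-- Setting the variables outside `I` to zero keeps the monomials supported in `I`;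
-- inclusion–exclusion leaves those in which every variable occurs.
theorem sum_neg_one_pow_mul_eval {ι : Type*} [Fintype ι] (p : MvPolynomial ι ℝ) (w : ι → ℝ) :
    ∑ I : Finset ι, (-1 : ℝ) ^ (Fintype.card ι - I.card) *
        MvPolynomial.eval (fun i => if i ∈ I then w i else 0) p =
      ∑ m ∈ p.support, if m.support = Finset.univ then p.coeff m * ∏ i, w i ^ m i else 0 := by
  simp only [MvPolynomial.eval_eq', Finset.mul_sum]
  rw [Finset.sum_comm]
  refine Finset.sum_congr rfl fun m _ => ?_
  rw [← sum_neg_one_pow_ite_subset]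
  refine Finset.sum_congr rfl fun I _ => ?_
  congr 1
  split_ifs with hI
  · congr 1
    refine Finset.prod_congr rfl fun i _ => ?_
    split_ifs with hi
    · rfl
    · rw [Finsupp.notMem_support_iff.1 fun hm => hi (hI hm), pow_zero, pow_zero]
  · obtain ⟨i, hi, hiI⟩ := Finset.not_subset.1 hI
    rw [Finset.prod_eq_zero (Finset.mem_univ i), mul_zero]
    rw [if_neg hiI, zero_pow (Finsupp.mem_support_iff.1 hi)]

/-- The alternating sum of the values of `f` on the partial sums of a family. -/
def altSum {ι : Type*} [Fintype ι] (f : M → ℝ) (A : ι → M) : ℝ :=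
  ∑ I : Finset ι, (-1 : ℝ) ^ (Fintype.card ι - I.card) * f (∑ i ∈ I, A i)

open Classical in
theorem altSum_smul_eq_sum {ι : Type} [Fintype ι] {f : M → ℝ} {A : ι → M} {p : MvPolynomial ι ℝ}
    (hp : ∀ t : ι → ℝ≥0, f (∑ i, t i • A i) = MvPolynomial.eval (fun i => (t i : ℝ)) p)
    (w : ι → ℝ≥0) :
    altSum f (fun i => w i • A i) =
      ∑ m ∈ p.support, if m.support = Finset.univ then p.coeff m * ∏ i, (w i : ℝ) ^ m i else 0 := by
  rw [← sum_neg_one_pow_mul_eval, altSum]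
  refine Finset.sum_congr rfl fun I _ => ?_
  have := hp fun i => if i ∈ I then w i else 0
  simp only [ite_smul, zero_smul, Finset.sum_ite_mem, Finset.univ_inter] at this
  rw [this]
  congr 3 with i
  split_ifs <;> simp

/-- A monomial containing every variable has degree at least the number of variables, here more than
`k`. -/
theorem altSum_eq_zero {ι : Type} [Fintype ι] {k : ℕ} (hk : k < Fintype.card ι) {f : M → ℝ}
    (hf : IsHomogeneousPoly k f) (A : ι → M) : altSum f A = 0 := by
  classical
  obtain ⟨p, hp, hfp⟩ := hf ι A
  have := altSum_smul_eq_sum hfp 1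
  simp only [Pi.one_apply, one_smul] at this
  rw [this]
  refine Finset.sum_eq_zero fun m hm => if_neg fun hms => ?_
  have hdeg : m.degree = k := by
    rw [Finsupp.degree_eq_weight_one]
    exact hp (MvPolynomial.mem_support_iff.1 hm)
  rw [Finsupp.degree_apply, hms] at hdeg
  have : ∑ i : ι, 1 ≤ ∑ i, m i := Finset.sum_le_sum fun i _ =>
    Nat.one_le_iff_ne_zero.2 (Finsupp.mem_support_iff.1 (hms ▸ Finset.mem_univ i))
  simp only [Finset.sum_const, Finset.card_univ, smul_eq_mul, mul_one] at this
  omega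

/-- With `k` variables in degree `k`, the product of all the variables is the only monomial that
survives. Keeping the weights `w` lets homogeneity in one argument be read off the same polynomial.
-/
theorem altSum_smul_eq_coeff {k : ℕ} {f : M → ℝ} {A : Fin k → M} {p : MvPolynomial (Fin k) ℝ}
    (hpk : p.IsHomogeneous k)
    (hp : ∀ t : Fin k → ℝ≥0, f (∑ i, t i • A i) = MvPolynomial.eval (fun i => (t i : ℝ)) p)
    (w : Fin k → ℝ≥0) :
    altSum f (fun i => w i • A i) =
      p.coeff (Finsupp.equivFunOnFinite.symm fun _ => 1) * ∏ i, (w i : ℝ) := by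
  classical
  rw [altSum_smul_eq_sum hp]
  have hone : ∀ m ∈ p.support, m.support = Finset.univ →
      m = Finsupp.equivFunOnFinite.symm fun _ => 1 := by
    intro m hm hms
    have hdeg : m.degree = k := by
      rw [Finsupp.degree_eq_weight_one]
      exact hpk (MvPolynomial.mem_support_iff.1 hm)
    rw [Finsupp.degree_apply, hms] at hdeg
    have hle : ∀ i ∈ Finset.univ, 1 ≤ m i := fun i _ =>
      Nat.one_le_iff_ne_zero.2 (Finsupp.mem_support_iff.1 (hms ▸ Finset.mem_univ i))
    have := (Finset.sum_eq_sum_iff_of_le hle).1 (by simp [hdeg])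
    ext i
    simpa using (this i (Finset.mem_univ i)).symm
  by_cases h1 : (Finsupp.equivFunOnFinite.symm fun _ => 1) ∈ p.support
  · rw [Finset.sum_eq_single_of_mem _ h1]
    · rw [if_pos]
      · simp
      · ext i; simp
    · intro m hm hne
      exact if_neg fun hms => hne (hone m hm hms)
  · rw [MvPolynomial.notMem_support_iff.1 h1, zero_mul]
    refine Finset.sum_eq_zero fun m hm => if_neg fun hms => h1 ?_
    rwa [← hone m hm hms]

theorem altSum_eq_coeff {k : ℕ} {f : M → ℝ} {A : Fin k → M} {p : MvPolynomial (Fin k) ℝ}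
    (hpk : p.IsHomogeneous k)
    (hp : ∀ t : Fin k → ℝ≥0, f (∑ i, t i • A i) = MvPolynomial.eval (fun i => (t i : ℝ)) p) :
    altSum f A = p.coeff (Finsupp.equivFunOnFinite.symm fun _ => 1) := by
  simpa using altSum_smul_eq_coeff hpk hp 1

theorem altSum_update_smul {k : ℕ} {f : M → ℝ} (hf : IsHomogeneousPoly k f) (A : Fin k → M)
    (i : Fin k) (c : ℝ≥0) (B : M) :
    altSum f (Function.update A i (c • B)) = c * altSum f (Function.update A i B) := by
  obtain ⟨p, hp, hfp⟩ := hf _ (Function.update A i B)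
  have := altSum_smul_eq_coeff hp hfp (Function.update 1 i c)
  rw [altSum_eq_coeff hp hfp, mul_comm]
  convert this using 2
  · ext j
    by_cases hj : j = i
    · subst hj; simp
    · simp [hj]
  · rw [← NNReal.coe_prod, Finset.prod_update_of_mem (Finset.mem_univ i)]
    simp

theorem altSum_eq_sum_powerset {H ι : Type*} [AddCommMonoid H] [Fintype ι] (f : H → ℝ)
    (A : ι → H) :
    altSum f A = (-1) ^ Fintype.card ι *
      ∑ I ∈ Finset.univ.powerset, (-1 : ℝ) ^ I.card * f (∑ i ∈ I, A i) := by
  rw [altSum, Finset.mul_sum, Finset.powerset_univ]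
  refine Finset.sum_congr rfl fun I _ => ?_
  rw [← mul_assoc, ← pow_add]
  have h := I.card_le_univ
  have : Fintype.card ι + I.card = (Fintype.card ι - I.card) + 2 * I.card := by omega
  rw [this, pow_add, pow_mul]
  simp

theorem altSum_update_eq {H : Type*} [AddCommMonoid H] {k : ℕ} (f : H → ℝ) (A : Fin k → H)
    (i : Fin k) (B : H) :
    altSum f (Function.update A i B) = (-1) ^ k * ∑ I ∈ (Finset.univ.erase i).powerset,
      (-1 : ℝ) ^ I.card * (f (∑ j ∈ I, A j) - f (B + ∑ j ∈ I, A j)) := by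
  rw [altSum_eq_sum_powerset, Fintype.card_fin, ← Finset.insert_erase (Finset.mem_univ i),
    Finset.sum_powerset_insert (Finset.notMem_erase i _), ← Finset.sum_add_distrib]
  congr 1
  rw [Finset.erase_insert (Finset.notMem_erase i _)]
  refine Finset.sum_congr rfl fun I hI => ?_
  have hi : i ∉ I := fun h => Finset.notMem_erase i _ (Finset.mem_powerset.1 hI h)
  rw [Finset.card_insert_of_notMem hi, Finset.sum_insert hi, Function.update_self,
    Finset.sum_update_of_notMem hi]
  ring

/-- The defect of additivity is itself the alternating sum of the `k + 1` elements obtained by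
putting `B` in place `i` and adjoining `C`, which vanishes in degree `k`. -/
theorem altSum_update_add {k : ℕ} {f : M → ℝ} (hf : IsHomogeneousPoly k f) (A : Fin k → M)
    (i : Fin k) (B C : M) :
    altSum f (Function.update A i (B + C)) =
      altSum f (Function.update A i B) + altSum f (Function.update A i C) := by
  have h := altSum_eq_zero (ι := Option (Fin k)) (by simp) hf
    (fun o => o.elim C (Function.update A i B))
  set e : Fin k ↪ Option (Fin k) := Function.Embedding.some with he
  have hu : (Finset.univ : Finset (Option (Fin k))) =
      insert none (insert (some i) ((Finset.univ.erase i).map e)) := by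
    ext o
    rcases o with _ | j
    · simp
    · by_cases hj : j = i <;> simp [hj, he]
  have hn : none ∉ insert (some i) ((Finset.univ.erase i).map e) := by simp [he]
  have hs : some i ∉ (Finset.univ.erase i).map e := by simp [he]
  have hpow : ((Finset.univ.erase i).map e).powerset =
      (Finset.univ.erase i).powerset.image (fun I => I.map e) := by
    classical
    simp only [Finset.map_eq_image]
    rw [Finset.powerset_image]
  rw [altSum_eq_sum_powerset, hu, Finset.sum_powerset_insert hn, Finset.sum_powerset_insert hs,
    Finset.sum_powerset_insert hs, hpow,
    Finset.sum_image (Finset.map_injective e).injOn, Finset.sum_image (Finset.map_injective e).injOn,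
    Finset.sum_image (Finset.map_injective e).injOn, Finset.sum_image (Finset.map_injective e).injOn,
    mul_eq_zero, or_iff_right (pow_ne_zero _ (by norm_num)), ← Finset.sum_add_distrib,
    ← Finset.sum_add_distrib, ← Finset.sum_add_distrib] at h
  rw [altSum_update_eq, altSum_update_eq, altSum_update_eq, ← mul_add, ← sub_eq_zero, ← mul_sub,
    ← Finset.sum_add_distrib, ← Finset.sum_sub_distrib, mul_eq_zero]
  right
  rw [← neg_eq_zero, ← h, ← Finset.sum_neg_distrib]
  refine Finset.sum_congr rfl fun I hI => ?_
  have hi : i ∉ I := fun h => Finset.notMem_erase i _ (Finset.mem_powerset.1 hI h)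
  have hsi : some i ∉ I.map e := by simpa [he] using hi
  have hni : none ∉ I.map e := by simp [he]
  have hni' : none ∉ insert (some i) (I.map e) := by simp [he]
  have hsum : ∑ j ∈ I, Function.update A i B j = ∑ j ∈ I, A j :=
    Finset.sum_update_of_notMem hi _ _
  simp only [Finset.card_insert_of_notMem hni', Finset.card_insert_of_notMem hni,
    Finset.card_insert_of_notMem hsi, Finset.sum_insert hni', Finset.sum_insert hni,
    Finset.sum_insert hsi, Finset.sum_map, Finset.card_map, Option.elim_none, Option.elim_some,
    Function.update_self]
  have hsum' : ∑ j ∈ I, (e j).elim C (Function.update A i B) = ∑ j ∈ I, A j := hsum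
  rw [hsum', add_left_comm C B, ← add_assoc B C]
  ring

theorem altSum_comp_perm {H : Type*} [AddCommMonoid H] {k : ℕ} (f : H → ℝ) (A : Fin k → H)
    (σ : Equiv.Perm (Fin k)) :
    altSum f (fun i => A (σ i)) = altSum f A := by
  exact Fintype.sum_equiv (Equiv.finsetCongr σ) _ _ fun I => by simp

/-- By homogeneity this is the k-th finite difference of x^k at 0, times `f A`. -/
theorem altSum_const {k : ℕ} {f : M → ℝ} (hf : ∀ (c : ℝ≥0) (A : M), f (c • A) = (c : ℝ) ^ k * f A)
    (A : M) : altSum f (fun _ : Fin k => A) = k.factorial * f A := by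
  have h1 : ∀ I : Finset (Fin k), f (∑ _i ∈ I, A) = (I.card : ℝ) ^ k * f A := by
    intro I
    rw [Finset.sum_const, ← Nat.cast_smul_eq_nsmul ℝ≥0, hf, NNReal.coe_natCast]
  simp only [altSum, h1, Fintype.card_fin, ← mul_assoc]
  rw [← Finset.sum_mul]
  congr 1
  have h2 := congrFun (fwdDiff_iter_eq_factorial (R := ℝ) (n := k)) 0
  rw [fwdDiff_iter_eq_sum_shift] at h2
  rw [← Finset.powerset_univ, Finset.sum_powerset_apply_card (fun j : ℕ =>
    (-1 : ℝ) ^ (k - j) * (j : ℝ) ^ k), Finset.card_univ, Fintype.card_fin]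
  refine Eq.trans (Finset.sum_congr rfl fun j _ => ?_) h2
  rw [nsmul_eq_mul, zsmul_eq_mul]
  push_cast
  simp only [nsmul_eq_mul, mul_one, zero_add]
  ring

/-- A symmetric multilinear function is the polarization of its restriction to the diagonal. -/
theorem altSum_diagonal {k : ℕ} (L : MultilinearMap ℝ≥0 (fun _ : Fin k => M) ℝ)
    (hL : ∀ (σ : Equiv.Perm (Fin k)) (A : Fin k → M), L (fun i => A (σ i)) = L A)
    (A : Fin k → M) : altSum (fun B => L fun _ => B) A = k.factorial * L A := by
  classical
  -- Expand by multilinearity over index maps `r` with image in `I`. The alternating sum keeps the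
  -- surjective ones, that is, the `k!` permutations, and symmetry makes their terms equal.
  have h1 : ∀ I : Finset (Fin k), L (fun _ => ∑ i ∈ I, A i) =
      ∑ r : Fin k → Fin k, if Finset.univ.image r ⊆ I then L (fun i => A (r i)) else 0 := by
    intro I
    rw [L.map_sum_finset (fun _ => A) (fun _ => I), ← Finset.sum_filter]
    refine Finset.sum_congr ?_ fun _ _ => rfl
    ext r
    simp [Finset.subset_iff]
  have h2 : ∀ r : Fin k → Fin k, (if Finset.univ.image r = Finset.univ then
      L (fun i => A (r i)) else 0) = if Function.Bijective r then L A else 0 := by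
    intro r
    have hr' : Finset.univ.image r = Finset.univ ↔ Function.Bijective r := by
      rw [← Finite.surjective_iff_bijective]
      simp [Finset.eq_univ_iff_forall, Function.Surjective]
    exact if_ctx_congr hr'
      (fun hr => hL (Equiv.ofBijective r hr) A) fun _ => rfl
  simp only [altSum, h1, Finset.mul_sum]
  rw [Finset.sum_comm]
  simp only [sum_neg_one_pow_ite_subset]
  rw [Finset.sum_congr rfl fun r _ => h2 r, ← Finset.sum_filter, Finset.sum_const, nsmul_eq_mul]
  congr 2
  rw [← Fintype.card_subtype]
  have := Fintype.card_congr (Equiv.ofBijective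
    (fun σ : Equiv.Perm (Fin k) => (⟨σ, σ.bijective⟩ : {r : Fin k → Fin k // Function.Bijective r}))
    ⟨fun σ τ h => Equiv.ext fun i => congrFun (congrArg Subtype.val h) i,
      fun r => ⟨Equiv.ofBijective r.1 r.2, rfl⟩⟩)
  rw [← this, Fintype.card_perm, Fintype.card_fin]

end Polarization

/-! ## Volumes of projections of polytopes -/

section Faces

open MeasureTheory

variable {n : ℕ}

theorem Polytope.convex (Γ : Polytope n) : Convex ℝ Γ.pts := Γ.1.convex

theorem Polytope.isCompact (Γ : Polytope n) : IsCompact Γ.pts := Γ.1.isCompact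

theorem Polytope.nonempty (Γ : Polytope n) : Γ.pts.Nonempty := Γ.1.nonempty

/-- The volume of the projection on `E` of a polytope. -/
def volP (E : Submodule ℝ (Euc n)) (Γ : Polytope n) : ℝ := volOn E Γ.pts

theorem Polytope.exists_pts_eq_range (Γ : Polytope n) :
    ∃ (N : ℕ) (a : Fin N → Euc n), 0 < N ∧ Γ.pts = convexHull ℝ (Set.range a) := by
  obtain ⟨s, hs, hΓ⟩ := Γ.exists_pts_eq
  have hne : s.Nonempty := by
    have := Γ.nonempty
    rw [hΓ] at this
    exact convexHull_nonempty_iff.1 this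
  obtain ⟨N, a, ha⟩ := hs.fin_param
  refine ⟨N, a, ?_, ?_⟩
  · obtain ⟨x, hx⟩ := hne
    rw [← ha.2] at hx
    obtain ⟨i, -⟩ := hx
    exact i.pos
  · rw [ha.2, hΓ]

theorem volP_smul (E : Submodule ℝ (Euc n)) (c : ℝ≥0) (Γ : Polytope n) :
    volP E (c • Γ) = (c : ℝ) ^ Module.finrank ℝ E * volP E Γ := by
  have h : E.orthogonalProjectionOnto '' ((c : ℝ) • Γ.pts) =
      (c : ℝ) • E.orthogonalProjectionOnto '' Γ.pts := image_smul_set _ _ _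
  rw [volP, volP, Polytope.pts_smul, volOn, volOn, h, Measure.real, Measure.addHaar_smul,
    ENNReal.toReal_mul, ENNReal.toReal_ofReal (abs_nonneg _), abs_of_nonneg (by positivity),
    Measure.real]

/-- Projection is linear, so Minkowski combinations project to Minkowski combinations; the number of
points spanning `A` bounds the degree uniformly in `Q`. -/
theorem isHomogeneousPoly_volP (E : Submodule ℝ (Euc n)) :
    IsHomogeneousPoly (Module.finrank ℝ E) (volP E) := by
  refine IsHomogeneousPoly.of_polynomial (fun A => ?_) (volP_smul E)
  obtain ⟨N, a, hN, hA⟩ := A.exists_pts_eq_range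
  refine ⟨N, fun Q => ?_⟩
  obtain ⟨p, hpd, hp⟩ := exists_polynomial_measureReal_add_smul
    (stdOrthonormalBasis ℝ E).toBasis.addHaar hN (fun i => E.orthogonalProjectionOnto (a i))
    (Q.isCompact.image E.orthogonalProjectionOnto.continuous)
    (Q.convex.linear_image E.orthogonalProjectionOnto.toLinearMap)
  refine ⟨p, hpd, fun s => ?_⟩
  rw [← hp s s.2, volP, volOn, Polytope.pts_add, Polytope.pts_smul, Set.image_add,
    image_smul_set, hA]
  have h : E.orthogonalProjectionOnto '' convexHull ℝ (Set.range a) =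
      convexHull ℝ (Set.range fun i => E.orthogonalProjectionOnto (a i)) := by
    have := E.orthogonalProjectionOnto.toLinearMap.image_convexHull (Set.range a)
    rw [← Set.range_comp] at this
    exact this
  rw [h]

/-- On directions inside `E` the projection is the identity, so the image of `A` lies in a proper
affine subspace of `E`. -/
theorem volOn_eq_zero_of_lt {E : Submodule ℝ (Euc n)} {A : Set (Euc n)} (h : dirSpace A < E) :
    volOn E A = 0 := by
  rcases A.eq_empty_or_nonempty with rfl | ⟨a, ha⟩
  · simp [volOn]
  set F : Submodule ℝ E := (dirSpace A).comap E.subtype with hF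
  have hF' : F ≠ ⊤ := by
    intro hF'
    refine h.not_ge fun x hx => ?_
    have : (⟨x, hx⟩ : E) ∈ F := hF' ▸ Submodule.mem_top
    exact this
  set G : AffineSubspace ℝ E := AffineSubspace.mk' (E.orthogonalProjectionOnto a) F with hG
  have hG' : G ≠ ⊤ := by
    intro hG'
    refine hF' ?_
    rw [← AffineSubspace.direction_mk' (E.orthogonalProjectionOnto a) F, ← hG, hG',
      AffineSubspace.direction_top]
  have hsub : E.orthogonalProjectionOnto '' A ⊆ G := by
    rintro _ ⟨x, hx, rfl⟩
    rw [hG, SetLike.mem_coe, AffineSubspace.mem_mk', vsub_eq_sub, ← map_sub]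
    have hxa : x - a ∈ dirSpace A := vsub_mem_vectorSpan ℝ hx ha
    rw [hF, Submodule.mem_comap, Submodule.subtype_apply,
      Submodule.orthogonalProjectionOnto_mem_subspace_eq_self ⟨x - a, h.le hxa⟩]
    exact hxa
  rw [volOn, Measure.real, measure_mono_null hsub (Measure.addHaar_affineSubspace _ G hG'),
    ENNReal.toReal_zero]

theorem dirSpace_le_dirSpace_add (A : Set (Euc n)) {B : Set (Euc n)} (hB : B.Nonempty) :
    dirSpace A ≤ dirSpace (A + B) := by
  obtain ⟨b, hb⟩ := hB
  refine Submodule.span_le.2 ?_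
  rintro _ ⟨x, hx, y, hy, rfl⟩
  have := vsub_mem_vectorSpan ℝ (Set.add_mem_add hx hb) (Set.add_mem_add hy hb)
  simpa using this

theorem volP_sum_eq_zero_of_lt {E : Submodule ℝ (Euc n)} {k : ℕ} {F : Fin k → Polytope n}
    (h : dirSpace (∑ ℓ, F ℓ).pts < E) (I : Finset (Fin k)) : volP E (∑ ℓ ∈ I, F ℓ) = 0 := by
  refine volOn_eq_zero_of_lt (lt_of_le_of_lt ?_ h)
  rw [← Finset.sum_add_sum_compl I, Polytope.pts_add]
  exact dirSpace_le_dirSpace_add _ (Polytope.nonempty _)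

theorem mixedVolume_eq_altSum {k : ℕ} {E : Submodule ℝ (Euc n)} (hE : Module.finrank ℝ E = k)
    (F : Fin k → Polytope n) :
    mixedVolume E (fun ℓ => (F ℓ).pts) = altSum (volP E) F / k.factorial := by
  obtain ⟨p, hp, hvol⟩ := isHomogeneousPoly_volP E (Fin k) F
  rw [hE] at hp
  have hpv : IsVolPoly E (fun ℓ => (F ℓ).pts) p := by
    intro t ht
    lift t to Fin k → ℝ≥0 using ht
    rw [← hvol t, volP, Polytope.pts_sum]
    rfl
  rw [mixedVolume_eq hpv, altSum_eq_coeff hp hvol]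

/-! ## Exposed faces -/

/-- The face of `A` in the direction `v`. -/
def exposedFace (A : Set (Euc n)) (v : Euc n) : Set (Euc n) := A ∩ supportHyp A v

theorem mem_exposedFace_iff {A : Set (Euc n)} (hA : IsCompact A) {v x : Euc n} :
    x ∈ exposedFace A v ↔ x ∈ A ∧ ∀ y ∈ A, inner ℝ v y ≤ inner ℝ v x := by
  have hbdd : BddAbove ((fun x => inner ℝ v x) '' A) := (hA.image (by fun_prop)).bddAbove
  constructor
  · rintro ⟨hx, hv⟩
    refine ⟨hx, fun y hy => ?_⟩
    have hv' : inner ℝ v x = supportFun A v := hv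
    rw [hv']
    exact le_csSup hbdd ⟨y, hy, rfl⟩
  · rintro ⟨hx, hv⟩
    refine ⟨hx, le_antisymm (le_csSup hbdd ⟨x, hx, rfl⟩) (csSup_le ⟨_, x, hx, rfl⟩ ?_)⟩
    rintro _ ⟨y, hy, rfl⟩
    exact hv y hy

theorem isFace_exposedFace (Γ : Polytope n) (v : Euc n) : IsFace Γ.pts (exposedFace Γ.pts v) := by
  refine ⟨⟨Set.inter_subset_left, ?_⟩, ?_, ?_⟩
  · rintro x hx y hy z hz ⟨a, b, ha, hb, hab, rfl⟩
    rw [mem_exposedFace_iff Γ.isCompact] at hz ⊢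
    refine ⟨hx, fun w hw => (hz.2 w hw).trans ?_⟩
    have h1 := hz.2 y hy
    simp only [inner_add_right, inner_smul_right] at h1 ⊢
    have : b = 1 - a := by linarith
    subst this
    nlinarith
  · intro x hx y hy a b ha hb hab
    rw [mem_exposedFace_iff Γ.isCompact] at hx hy ⊢
    refine ⟨Γ.convex hx.1 hy.1 ha hb hab, fun w hw => ?_⟩
    have h1 := mul_le_mul_of_nonneg_left (hx.2 w hw) ha
    have h2 := mul_le_mul_of_nonneg_left (hy.2 w hw) hb
    simp only [inner_add_right, inner_smul_right]
    calc inner ℝ v w = a * inner ℝ v w + b * inner ℝ v w := by rw [← add_mul, hab, one_mul]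
      _ ≤ _ := add_le_add h1 h2
  · obtain ⟨x, hx, hmax⟩ := Γ.isCompact.exists_isMaxOn Γ.nonempty
      (f := fun x => inner ℝ v x) (by fun_prop)
    exact ⟨x, (mem_exposedFace_iff Γ.isCompact).2 ⟨hx, fun y hy => hmax hy⟩⟩

/-- A face of a polytope, as a polytope. -/
def IsFace.toPolytope {Γ : Polytope n} {Δ : Set (Euc n)} (h : IsFace Γ.pts Δ) : Polytope n :=
  ⟨⟨Δ, h.convex, h.isCompact, h.nonempty⟩, by
    obtain ⟨s, hs, hΓ⟩ := Γ.exists_pts_eq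
    rw [hΓ] at h
    exact ⟨s ∩ Δ, hs.inter_of_left Δ, h.eq_convexHull⟩⟩

theorem exposedFace_add (Γ Γ' : Polytope n) (v : Euc n) :
    exposedFace (Γ + Γ').pts v = exposedFace Γ.pts v + exposedFace Γ'.pts v := by
  ext x
  rw [mem_exposedFace_iff (Polytope.isCompact _), Polytope.pts_add]
  constructor
  · rintro ⟨⟨a, ha, b, hb, rfl⟩, hx⟩
    refine ⟨a, (mem_exposedFace_iff Γ.isCompact).2 ⟨ha, fun y hy => ?_⟩,
      b, (mem_exposedFace_iff Γ'.isCompact).2 ⟨hb, fun y hy => ?_⟩, rfl⟩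
    · have := hx _ (Set.add_mem_add hy hb)
      simpa [inner_add_right] using this
    · have := hx _ (Set.add_mem_add ha hy)
      simpa [inner_add_right] using this
  · rintro ⟨a, ha, b, hb, rfl⟩
    rw [mem_exposedFace_iff (Polytope.isCompact _)] at ha hb
    refine ⟨Set.add_mem_add ha.1 hb.1, ?_⟩
    rintro _ ⟨y, hy, z, hz, rfl⟩
    simp only [inner_add_right]
    exact add_le_add (ha.2 y hy) (hb.2 z hz)

theorem exposedFace_smul (c : ℝ≥0) (Γ : Polytope n) (v : Euc n) :
    exposedFace (c • Γ).pts v = (c : ℝ) • exposedFace Γ.pts v := by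
  rcases eq_or_ne c 0 with rfl | hc
  · rw [NNReal.coe_zero, Set.zero_smul_set (isFace_exposedFace Γ v).nonempty, zero_smul]
    ext x
    rw [mem_exposedFace_iff (Polytope.isCompact _), Polytope.pts_zero]
    constructor
    · exact fun hx => hx.1
    · rintro rfl
      exact ⟨rfl, fun y hy => by rw [Set.mem_singleton_iff.1 hy]⟩
  have hc' : (0 : ℝ) < c := NNReal.coe_pos.2 (pos_iff_ne_zero.2 hc)
  ext x
  rw [mem_exposedFace_iff (Polytope.isCompact _), Polytope.pts_smul]
  constructor
  · rintro ⟨⟨a, ha, rfl⟩, hx⟩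
    refine ⟨a, (mem_exposedFace_iff Γ.isCompact).2 ⟨ha, fun y hy => ?_⟩, rfl⟩
    have := hx _ (Set.smul_mem_smul_set hy)
    simp only [inner_smul_right] at this
    exact le_of_mul_le_mul_left this hc'
  · rintro ⟨a, ha, rfl⟩
    rw [mem_exposedFace_iff (Polytope.isCompact _)] at ha
    refine ⟨Set.smul_mem_smul_set ha.1, ?_⟩
    rintro _ ⟨y, hy, rfl⟩
    simp only [inner_smul_right]
    exact mul_le_mul_of_nonneg_left (ha.2 y hy) hc'.le

/-- The face in the direction `v`, as a linear map. -/
def faceMap (v : Euc n) : Polytope n →ₗ[ℝ≥0] Polytope n where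
  toFun Γ := (isFace_exposedFace Γ v).toPolytope
  map_add' Γ Γ' := Polytope.ext (exposedFace_add Γ Γ' v)
  map_smul' c Γ := Polytope.ext (exposedFace_smul c Γ v)

theorem pts_faceMap (v : Euc n) (Γ : Polytope n) : (faceMap v Γ).pts = exposedFace Γ.pts v := rfl

/-- The faces of the `Γ ℓ` in direction `v` add up to the face of the sum, so `summand_unique`
identifies them with the summands. This makes the mixed volume in the definition a function of
`faceMap v (Γ ℓ)`. -/
theorem summand_exposedFace {k : ℕ} (Γ : Fin k → Polytope n) (v : Euc n) :
    summand (fun ℓ => (Γ ℓ).pts) (exposedFace (∑ ℓ, Γ ℓ).pts v) =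
      fun ℓ => (faceMap v (Γ ℓ)).pts := by
  have h := isFace_exposedFace (∑ ℓ, Γ ℓ) v
  rw [Polytope.pts_sum] at h
  rw [Polytope.pts_sum]
  refine (summand_unique h (fun ℓ => isFace_exposedFace (Γ ℓ) v) ?_).symm
  have := congrArg Polytope.pts (map_sum (faceMap v) Γ Finset.univ)
  rw [Polytope.pts_sum, pts_faceMap, Polytope.pts_sum] at this
  exact this.symm

/-! ### Dual cones and their measurability -/

theorem finite_isFace (Γ : Polytope n) : {Δ | IsFace Γ.pts Δ}.Finite := by
  obtain ⟨s, hs, hΓ⟩ := Γ.exists_pts_eq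
  refine (hs.finite_subsets.image (convexHull ℝ)).subset ?_
  intro Δ h
  have h' : IsFace Γ.pts Δ := h
  rw [hΓ] at h'
  exact ⟨s ∩ Δ, Set.inter_subset_left, h'.eq_convexHull.symm⟩

theorem dualCone_subset {Γ : Polytope n} {Δ : Set (Euc n)} :
    dualCone Γ.pts Δ ⊆ (dirSpace Δ)ᗮ := by
  intro v hv
  have hv' : Δ = exposedFace Γ.pts v := hv
  rw [SetLike.mem_coe, Submodule.mem_orthogonal']
  intro u hu
  refine Submodule.span_induction ?_ (by simp) ?_ ?_ hu
  · rintro _ ⟨x, hx, y, hy, rfl⟩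
    rw [hv'] at hx hy
    have h1 : inner ℝ v x = supportFun Γ.pts v := hx.2
    have h2 : inner ℝ v y = supportFun Γ.pts v := hy.2
    change inner ℝ v (x - y) = 0
    rw [inner_sub_right, h1, h2, sub_self]
  · intro x y _ _ hx hy
    rw [inner_add_right, hx, hy, add_zero]
  · intro a x _ hx
    rw [inner_smul_right, hx, mul_zero]

theorem isClosed_setOf_mem_exposedFace (Γ : Polytope n) (x : Euc n) :
    IsClosed {v | x ∈ exposedFace Γ.pts v} := by
  have : {v | x ∈ exposedFace Γ.pts v} =
      {_v | x ∈ Γ.pts} ∩ ⋂ y ∈ Γ.pts, {v : Euc n | inner ℝ v y ≤ inner ℝ v x} := by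
    ext v
    simp [mem_exposedFace_iff Γ.isCompact]
  rw [this]
  exact isClosed_const.inter (isClosed_iInter fun y => isClosed_iInter fun _ =>
    isClosed_le (by fun_prop) (by fun_prop))

theorem measurableSet_dualCone {Γ : Polytope n} {Δ : Set (Euc n)} (h : IsFace Γ.pts Δ) :
    MeasurableSet (dualCone Γ.pts Δ) := by
  obtain ⟨s, hs, hΓ⟩ := Γ.exists_pts_eq
  have hΔ : Δ = convexHull ℝ (s ∩ Δ) := IsFace.eq_convexHull (hΓ ▸ h)
  -- A face is the hull of the points of `s` it contains, so finitely many conditions decide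
  -- membership; each is closed or the complement of a closed condition.
  have : dualCone Γ.pts Δ = ⋂ x ∈ s, {v | x ∈ exposedFace Γ.pts v ↔ x ∈ Δ} := by
    ext v
    simp only [Set.mem_iInter]
    constructor
    · intro hv x _
      have hv' : Δ = exposedFace Γ.pts v := hv
      change x ∈ exposedFace Γ.pts v ↔ x ∈ Δ
      rw [← hv']
    · intro hv
      have hf : exposedFace Γ.pts v = convexHull ℝ (s ∩ exposedFace Γ.pts v) :=
        IsFace.eq_convexHull (hΓ ▸ isFace_exposedFace Γ v)
      have hs : s ∩ exposedFace Γ.pts v = s ∩ Δ := by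
        ext x
        exact and_congr_right fun hx => hv x hx
      change Δ = exposedFace Γ.pts v
      rw [hf, hs, ← hΔ]
  rw [this]
  refine hs.measurableSet_biInter fun x _ => ?_
  by_cases hx : x ∈ Δ
  · simpa [hx] using (isClosed_setOf_mem_exposedFace Γ x).measurableSet
  · have : {v | x ∈ exposedFace Γ.pts v ↔ x ∈ Δ} = {v | x ∈ exposedFace Γ.pts v}ᶜ := by
      ext v
      simp [hx]
    rw [this]
    exact (isClosed_setOf_mem_exposedFace Γ x).measurableSet.compl

end Faces

/-! ## The integral formula -/

section IntegralFormula

open MeasureTheory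

variable {n : ℕ}

/-- The Lebesgue measure of the unit ball of `Eᗮ`. -/
def normalMeasure (E : Submodule ℝ (Euc n)) : Measure Eᗮ :=
  (stdOrthonormalBasis ℝ Eᗮ).toBasis.addHaar.restrict (Metric.closedBall 0 1)

instance (E : Submodule ℝ (Euc n)) : IsFiniteMeasure (normalMeasure E) :=
  ⟨by
    rw [normalMeasure, Measure.restrict_apply_univ]
    exact (isCompact_closedBall _ _).measure_lt_top⟩

/-- The directions in `Eᗮ` that define the face `Δ` of `Γ`. -/
def normalCone (E : Submodule ℝ (Euc n)) (Γ Δ : Set (Euc n)) : Set Eᗮ :=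
  Subtype.val ⁻¹' dualCone Γ Δ

theorem measurableSet_normalCone (E : Submodule ℝ (Euc n)) {Γ : Polytope n} {Δ : Set (Euc n)}
    (h : IsFace Γ.pts Δ) : MeasurableSet (normalCone E Γ.pts Δ) :=
  measurable_subtype_coe (measurableSet_dualCone h)

/-- The normal cones of the faces partition `Eᗮ`, so any function of the selected face is a step
function of `w`. -/
theorem apply_exposedFace_eq_sum (E : Submodule ℝ (Euc n)) (Γ : Polytope n)
    (G : Set (Euc n) → ℝ) (w : Eᗮ) :
    G (exposedFace Γ.pts w) = ∑ Δ ∈ (finite_isFace Γ).toFinset,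
      (normalCone E Γ.pts Δ).indicator (fun _ => G Δ) w := by
  rw [Finset.sum_eq_single_of_mem (exposedFace Γ.pts w)
    ((finite_isFace Γ).mem_toFinset.2 (isFace_exposedFace Γ w))]
  · have hw : w ∈ normalCone E Γ.pts (exposedFace Γ.pts w) := rfl
    rw [Set.indicator_of_mem hw]
  · intro Δ _ hne
    have hw : w ∉ normalCone E Γ.pts Δ := hne
    exact Set.indicator_of_notMem hw _

theorem integrable_indicator_normalCone (E : Submodule ℝ (Euc n)) {Γ : Polytope n}
    {Δ : Set (Euc n)} (h : IsFace Γ.pts Δ) (c : ℝ) :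
    Integrable ((normalCone E Γ.pts Δ).indicator fun _ => c) (normalMeasure E) :=
  (integrable_const c).indicator (measurableSet_normalCone E h)

theorem integrable_apply_exposedFace (E : Submodule ℝ (Euc n)) (Γ : Polytope n)
    (G : Set (Euc n) → ℝ) :
    Integrable (fun w : Eᗮ => G (exposedFace Γ.pts w)) (normalMeasure E) := by
  simp only [apply_exposedFace_eq_sum E Γ G]
  exact integrable_finsetSum _ fun Δ hΔ =>
    integrable_indicator_normalCone E ((finite_isFace Γ).mem_toFinset.1 hΔ) _

theorem integral_apply_exposedFace (E : Submodule ℝ (Euc n)) (Γ : Polytope n)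
    (G : Set (Euc n) → ℝ) :
    ∫ w : Eᗮ, G (exposedFace Γ.pts w) ∂(normalMeasure E) = ∑ Δ ∈ (finite_isFace Γ).toFinset,
      (normalMeasure E).real (normalCone E Γ.pts Δ) * G Δ := by
  simp only [apply_exposedFace_eq_sum E Γ G]
  rw [integral_finsetSum _ fun Δ hΔ =>
    integrable_indicator_normalCone E ((finite_isFace Γ).mem_toFinset.1 hΔ) _]
  refine Finset.sum_congr rfl fun Δ hΔ => ?_
  rw [integral_indicator_const _
    (measurableSet_normalCone E ((finite_isFace Γ).mem_toFinset.1 hΔ)), smul_eq_mul]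

/-- The dual cone already lies in `(dirSpace Δ)ᗮ`, so the projection in `outerAngle` acts on it as
the identity. -/
theorem normalMeasure_normalCone {Γ : Polytope n} {Δ : Set (Euc n)} (h : IsFace Γ.pts Δ) :
    (ballVol (Module.finrank ℝ (dirSpace Δ)ᗮ))⁻¹ *
      (normalMeasure (dirSpace Δ)).real (normalCone (dirSpace Δ) Γ.pts Δ) =
      outerAngle Γ.pts Δ := by
  rw [outerAngle, volOn, normalMeasure,
    measureReal_restrict_apply (measurableSet_normalCone _ h)]
  congr 2
  ext w
  constructor
  · rintro ⟨hw, hb⟩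
    refine ⟨w, ⟨hw, ?_⟩, Submodule.orthogonalProjectionOnto_mem_subspace_eq_self w⟩
    simpa using hb
  · rintro ⟨v, ⟨hv, hb⟩, rfl⟩
    have hv' := Submodule.orthogonalProjectionOnto_mem_subspace_eq_self
      (⟨v, dualCone_subset hv⟩ : ((dirSpace Δ)ᗮ : Submodule ℝ (Euc n)))
    change (dirSpace Δ)ᗮ.orthogonalProjectionOnto v = _ at hv'
    rw [hv']
    refine ⟨hv, ?_⟩
    simpa using hb

/-- The cone lies in `(dirSpace Δ)ᗮ`, which cuts `Eᗮ` in a proper subspace unless `dirSpace Δ ≤ E`.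
-/
theorem normalMeasure_normalCone_eq_zero {E : Submodule ℝ (Euc n)} {Γ : Polytope n}
    {Δ : Set (Euc n)} (h : ¬ dirSpace Δ ≤ E) :
    (normalMeasure E).real (normalCone E Γ.pts Δ) = 0 := by
  set F : Submodule ℝ Eᗮ := ((dirSpace Δ)ᗮ).comap Eᗮ.subtype with hF
  have hF' : F ≠ ⊤ := by
    intro hF'
    refine h ?_
    rw [← Submodule.orthogonal_le_orthogonal_iff]
    intro x hx
    have : (⟨x, hx⟩ : (Eᗮ : Submodule ℝ (Euc n))) ∈ F := hF' ▸ Submodule.mem_top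
    exact this
  have hsub : normalCone E Γ.pts Δ ⊆ F := fun w hw => dualCone_subset hw
  rw [Measure.real, measure_mono_null hsub, ENNReal.toReal_zero]
  exact Measure.absolutelyContinuous_of_le Measure.restrict_le_self
    (Measure.addHaar_submodule _ F hF')

open Classical in
/-- Sums over the `k`-dimensional faces, weighted by the outer angles, as sums of integrals. -/
theorem sum_faces_eq_sum_integral (φ : Submodule ℝ (Euc n) → ℝ) {k : ℕ} (Γ : Polytope n)
    (G : Submodule ℝ (Euc n) → Set (Euc n) → ℝ) (S : Finset (Submodule ℝ (Euc n)))
    (hS : ∀ E ∈ S, Module.finrank ℝ E = k) (hΓS : ∀ Δ ∈ faces Γ.pts k, dirSpace Δ ∈ S)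
    (hG : ∀ E ∈ S, ∀ v, dirSpace (exposedFace Γ.pts v) < E → G E (exposedFace Γ.pts v) = 0) :
    ∑ Δ ∈ (finite_faces Γ k).toFinset,
        φ (dirSpace Δ) * G (dirSpace Δ) Δ * outerAngle Γ.pts Δ =
      ∑ E ∈ S, φ E * (ballVol (Module.finrank ℝ Eᗮ))⁻¹ *
        ∫ w : Eᗮ, G E (exposedFace Γ.pts w) ∂(normalMeasure E) := by
  -- Equal direction spaces give the outer angle, a strictly smaller one makes `G` vanish by `hG`,
  -- and any other gives a null cone. A face with empty normal cone contributes nothing, so it need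
  -- not be known that every face is exposed.
  have hterm : ∀ E ∈ S, ∀ Δ ∈ (finite_isFace Γ).toFinset,
      φ E * (ballVol (Module.finrank ℝ Eᗮ))⁻¹ *
        ((normalMeasure E).real (normalCone E Γ.pts Δ) * G E Δ) =
      if dirSpace Δ = E then φ (dirSpace Δ) * G (dirSpace Δ) Δ * outerAngle Γ.pts Δ else 0 := by
    intro E hE Δ hΔ
    have hface : IsFace Γ.pts Δ := (finite_isFace Γ).mem_toFinset.1 hΔ
    split_ifs with h
    · subst h
      rw [← normalMeasure_normalCone hface]
      ring
    · by_cases hle : dirSpace Δ ≤ E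
      · rcases (normalCone E Γ.pts Δ).eq_empty_or_nonempty with h0 | ⟨w, hw⟩
        · rw [h0]
          simp
        · have hw' : Δ = exposedFace Γ.pts w := hw
          have := hG E hE w (hw' ▸ lt_of_le_of_ne hle h)
          rw [← hw'] at this
          rw [this]
          ring
      · rw [normalMeasure_normalCone_eq_zero hle]
        ring
  simp only [integral_apply_exposedFace, Finset.mul_sum]
  rw [Finset.sum_congr rfl fun E hE => Finset.sum_congr rfl (hterm E hE), Finset.sum_comm]
  simp only [Finset.sum_ite_eq]
  rw [← Finset.sum_filter]
  refine Finset.sum_congr ?_ fun _ _ => rfl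
  ext Δ
  rw [Set.Finite.mem_toFinset, Finset.mem_filter, Set.Finite.mem_toFinset]
  exact ⟨fun h => ⟨h.1, hΓS Δ h⟩, fun h => ⟨h.1, hS _ h.2⟩⟩

/-- `S` is a set of `k`-dimensional subspaces containing the directions of all the
`k`-dimensional faces of `Γ`. -/
structure IsAdapted (k : ℕ) (S : Finset (Submodule ℝ (Euc n))) (Γ : Polytope n) : Prop where
  finrank_eq : ∀ E ∈ S, Module.finrank ℝ E = k
  mem : ∀ Δ ∈ faces Γ.pts k, dirSpace Δ ∈ S

/-- A common `S` allows the integral formulas of several polytopes to be compared term by term. -/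
theorem exists_isAdapted (k : ℕ) {ι : Type*} [Finite ι] (Γ : ι → Polytope n) :
    ∃ S : Finset (Submodule ℝ (Euc n)), ∀ i, IsAdapted k S (Γ i) := by
  have hfin : (⋃ i, dirSpace '' faces (Γ i).pts k).Finite :=
    Set.finite_iUnion fun i => (finite_faces (Γ i) k).image _
  refine ⟨hfin.toFinset, fun i => ⟨fun E hE => ?_, fun Δ hΔ => ?_⟩⟩
  · obtain ⟨j, Δ, hΔ, rfl⟩ := Set.mem_iUnion.1 (hfin.mem_toFinset.1 hE)
    exact hΔ.2
  · exact hfin.mem_toFinset.2 (Set.mem_iUnion.2 ⟨i, Δ, hΔ, rfl⟩)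

theorem intrinsicVol_eq_sum_integral (φ : Submodule ℝ (Euc n) → ℝ) {k : ℕ} {Γ : Polytope n}
    {S : Finset (Submodule ℝ (Euc n))} (hS : IsAdapted k S Γ) :
    intrinsicVol φ k Γ = ∑ E ∈ S, φ E * (ballVol (Module.finrank ℝ Eᗮ))⁻¹ *
      ∫ w : Eᗮ, volP E (faceMap w Γ) ∂(normalMeasure E) :=
  sum_faces_eq_sum_integral φ Γ volOn S hS.finrank_eq hS.mem
    fun _ _ _ h => volOn_eq_zero_of_lt h

theorem mixedVol_eq_sum_integral (φ : Submodule ℝ (Euc n) → ℝ) {k : ℕ} {Γ : Fin k → Polytope n}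
    {S : Finset (Submodule ℝ (Euc n))} (hS : IsAdapted k S (∑ ℓ, Γ ℓ)) :
    mixedVol φ Γ = ∑ E ∈ S, φ E * (ballVol (Module.finrank ℝ Eᗮ))⁻¹ *
      ∫ w : Eᗮ, altSum (volP E) (fun ℓ => faceMap w (Γ ℓ)) / k.factorial ∂(normalMeasure E) := by
  have hG : ∀ E ∈ S, ∀ v, mixedVolume E (summand (fun ℓ => (Γ ℓ).pts)
      (exposedFace (∑ ℓ, Γ ℓ).pts v)) =
      altSum (volP E) (fun ℓ => faceMap v (Γ ℓ)) / k.factorial := by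
    intro E hE v
    rw [summand_exposedFace]
    exact mixedVolume_eq_altSum (hS.finrank_eq E hE) fun ℓ => faceMap v (Γ ℓ)
  refine (sum_faces_eq_sum_integral φ (∑ ℓ, Γ ℓ)
    (fun E Δ => mixedVolume E (summand (fun ℓ => (Γ ℓ).pts) Δ)) S hS.finrank_eq hS.mem
    fun E hE v h => ?_).trans ?_
  -- If the face of the sum is degenerate in `E`, so are all partial sums of its summands; hence
  -- every term of the alternating sum is zero.
  · rw [← pts_faceMap, map_sum] at h
    rw [hG E hE, altSum, Finset.sum_eq_zero, zero_div]
    intro I _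
    rw [volP_sum_eq_zero_of_lt h, mul_zero]
  · refine Finset.sum_congr rfl fun E hE => ?_
    simp only [hG E hE]

theorem integrable_volP_faceMap (E : Submodule ℝ (Euc n)) (Γ : Polytope n) :
    Integrable (fun w : Eᗮ => volP E (faceMap w Γ)) (normalMeasure E) :=
  integrable_apply_exposedFace E Γ (volOn E)

theorem integrable_altSum_faceMap (E : Submodule ℝ (Euc n)) {k : ℕ} (Γ : Fin k → Polytope n) :
    Integrable (fun w : Eᗮ => altSum (volP E) fun ℓ => faceMap w (Γ ℓ)) (normalMeasure E) := by
  simp only [altSum, ← map_sum]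
  exact integrable_finsetSum _ fun I _ => (integrable_volP_faceMap E _).const_mul _

/-! ## Properties of the mixed `φ`-volumes -/

/-- Polarization already holds under the integral for each `w`, because `faceMap w` commutes with
the partial sums. The empty subset is still included here; its term vanishes by `intrinsicVol_zero`
once `k ≥ 1`. -/
theorem mixedVol_eq_altSum (φ : Submodule ℝ (Euc n) → ℝ) {k : ℕ} (Γ : Fin k → Polytope n) :
    mixedVol φ Γ = altSum (intrinsicVol φ k) Γ / k.factorial := by
  obtain ⟨S, hS⟩ := exists_isAdapted k fun I : Finset (Fin k) => ∑ ℓ ∈ I, Γ ℓ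
  rw [mixedVol_eq_sum_integral φ (hS Finset.univ), altSum, Finset.sum_div]
  simp only [fun I => intrinsicVol_eq_sum_integral φ (hS I)]
  simp only [integral_div, altSum, ← map_sum]
  simp only [Finset.mul_sum, Finset.sum_div]
  rw [Finset.sum_comm]
  refine Finset.sum_congr rfl fun E _ => ?_
  rw [integral_finsetSum _ fun I _ => (integrable_volP_faceMap E _).const_mul _, Finset.sum_div,
    Finset.mul_sum]
  refine Finset.sum_congr rfl fun I _ => ?_
  rw [integral_const_mul]
  ring

theorem intrinsicVol_zero (φ : Submodule ℝ (Euc n) → ℝ) {k : ℕ} (hk : 1 ≤ k) :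
    intrinsicVol φ k 0 = 0 := by
  obtain ⟨S, hS⟩ := exists_isAdapted k fun _ : Unit => (0 : Polytope n)
  rw [intrinsicVol_eq_sum_integral φ (hS ())]
  refine Finset.sum_eq_zero fun E hE => ?_
  have h : volP E 0 = 0 := by
    have := volP_smul E 0 0
    rw [(hS ()).finrank_eq E hE, zero_smul, NNReal.coe_zero, zero_pow (by omega), zero_mul] at this
    exact this
  simp [h]

theorem mixedVol_eq_polarization (φ : Submodule ℝ (Euc n) → ℝ) {k : ℕ} (hk : 1 ≤ k)
    (Γ : Fin k → Polytope n) :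
    mixedVol φ Γ = 1 / (k.factorial : ℝ) * ∑ I : Finset (Fin k) with I.Nonempty,
      (-1 : ℝ) ^ (k - I.card) * intrinsicVol φ k (∑ ℓ ∈ I, Γ ℓ) := by
  rw [mixedVol_eq_altSum, div_eq_inv_mul, one_div, altSum, Fintype.card_fin]
  congr 1
  symm
  refine Finset.sum_subset (Finset.filter_subset _ _) fun I _ hI => ?_
  rw [Finset.mem_filter, not_and, Finset.not_nonempty_iff_eq_empty] at hI
  rw [hI (Finset.mem_univ I), Finset.sum_empty, intrinsicVol_zero φ hk, mul_zero]

theorem isSymmetric_mixedVol (φ : Submodule ℝ (Euc n) → ℝ) (k : ℕ) :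
    IsSymmetric (k := k) (mixedVol φ) := by
  intro σ Γ
  rw [mixedVol_eq_altSum, mixedVol_eq_altSum, altSum_comp_perm]

theorem isKLinear_mixedVol (φ : Submodule ℝ (Euc n) → ℝ) (k : ℕ) :
    IsKLinear (k := k) (mixedVol φ) := by
  intro Γ ℓ a b A B
  obtain ⟨S, hS⟩ := exists_isAdapted k fun i : Fin 3 =>
    ∑ j, Function.update Γ ℓ (![a • A + b • B, A, B] i) j
  rw [mixedVol_eq_sum_integral (Γ := Function.update Γ ℓ (a • A + b • B)) φ (hS 0),
    mixedVol_eq_sum_integral (Γ := Function.update Γ ℓ A) φ (hS 1),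
    mixedVol_eq_sum_integral (Γ := Function.update Γ ℓ B) φ (hS 2), Finset.mul_sum, Finset.mul_sum, ← Finset.sum_add_distrib]
  refine Finset.sum_congr rfl fun E hE => ?_
  have hpoly : IsHomogeneousPoly k (volP E) := (hS 0).finrank_eq E hE ▸ isHomogeneousPoly_volP E
  have hupd : ∀ (w : Eᗮ) (C : Polytope n), (fun j => faceMap (w : Euc n) (Function.update Γ ℓ C j)) =
      Function.update (fun j => faceMap (w : Euc n) (Γ j)) ℓ (faceMap (w : Euc n) C) := by
    intro w C
    ext1 j
    exact Function.apply_update (fun _ => faceMap (w : Euc n)) Γ ℓ C j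
  -- Linearity for a fixed direction: `faceMap w` is linear and the alternating sum of a homogeneous
  -- polynomial function of degree `k` is multilinear.
  have hint : ∀ w : Eᗮ, altSum (volP E) (fun j => faceMap w (Function.update Γ ℓ (a • A + b • B) j)) =
      a * altSum (volP E) (fun j => faceMap w (Function.update Γ ℓ A j)) +
        b * altSum (volP E) (fun j => faceMap w (Function.update Γ ℓ B j)) := by
    intro w
    rw [hupd, hupd, hupd, map_add, map_smul, map_smul, altSum_update_add hpoly,
      altSum_update_smul hpoly, altSum_update_smul hpoly]
  change φ E * _ * ∫ w : Eᗮ, altSum (volP E)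
      (fun j => faceMap w (Function.update Γ ℓ (a • A + b • B) j)) / k.factorial ∂_ =
    a * (φ E * _ * ∫ w : Eᗮ, altSum (volP E)
      (fun j => faceMap w (Function.update Γ ℓ A j)) / k.factorial ∂_) +
    b * (φ E * _ * ∫ w : Eᗮ, altSum (volP E)
      (fun j => faceMap w (Function.update Γ ℓ B j)) / k.factorial ∂_)
  simp only [hint, integral_div]
  rw [integral_add ((integrable_altSum_faceMap E _).const_mul _)
    ((integrable_altSum_faceMap E _).const_mul _), integral_const_mul, integral_const_mul]
  ring

theorem mixedVol_diagonal (φ : Submodule ℝ (Euc n) → ℝ) {k : ℕ} (Γ : Polytope n) :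
    mixedVol φ (fun _ : Fin k => Γ) = intrinsicVol φ k Γ := by
  -- The mixed volume sums over the faces of the `k`-fold sum of `Γ`, the intrinsic one over those
  -- of `Γ`; with a common `S` both integrands involve only `faceMap w Γ`.
  obtain ⟨S, hS⟩ := exists_isAdapted k fun b : Bool => if b then ∑ _j : Fin k, Γ else Γ
  rw [mixedVol_eq_sum_integral φ (hS true), intrinsicVol_eq_sum_integral (Γ := Γ) φ (hS false)]
  refine Finset.sum_congr rfl fun E hE => ?_
  have hsmul : ∀ (c : ℝ≥0) (A : Polytope n), volP E (c • A) = (c : ℝ) ^ k * volP E A :=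
    (hS true).finrank_eq E hE ▸ volP_smul E
  have hk : (k.factorial : ℝ) ≠ 0 := by exact_mod_cast k.factorial_ne_zero
  simp only [altSum_const hsmul, mul_div_cancel_left₀ _ hk]

theorem altSum_diagonal_of_isKLinear {k : ℕ} {L : (Fin k → Polytope n) → ℝ} (hs : IsSymmetric L)
    (hL : IsKLinear L) (Γ : Fin k → Polytope n) :
    altSum (fun A => L fun _ => A) Γ = k.factorial * L Γ := by
  refine altSum_diagonal (MultilinearMap.mk' L (fun m i x y => ?_) fun m i c x => ?_) hs Γ
  -- The coefficients (1, 1) give additivity, and (c, 0) below give homogeneity.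
  · have := hL m i 1 1 x y
    simpa using this
  · have := hL m i c 0 x 0
    simpa [NNReal.smul_def] using this

end IntegralFormula

end PhiVolume

end

theorem mainTheorem10 (n k : ℕ) (hk : 1 ≤ k) (hkn : k ≤ n)
    (φ : Submodule ℝ (PhiVolume.Euc n) → ℝ) :
    (∀ Γ : Fin k → PhiVolume.Polytope n,
      PhiVolume.mixedVol φ Γ =
        1 / (k.factorial : ℝ) *
          ∑ I : Finset (Fin k) with I.Nonempty,
            (-1 : ℝ) ^ (k - I.card) * PhiVolume.intrinsicVol φ k (∑ ℓ ∈ I, Γ ℓ)) ∧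
    PhiVolume.IsSymmetric (k := k) (PhiVolume.mixedVol φ) ∧
    PhiVolume.IsKLinear (k := k) (PhiVolume.mixedVol φ) ∧
    (∀ Γ : PhiVolume.Polytope n,
      PhiVolume.mixedVol φ (fun _ : Fin k => Γ) = PhiVolume.intrinsicVol φ k Γ) ∧
    (∀ L : (Fin k → PhiVolume.Polytope n) → ℝ,
      PhiVolume.IsSymmetric L → PhiVolume.IsKLinear L →
      (∀ Γ : PhiVolume.Polytope n, L (fun _ => Γ) = PhiVolume.intrinsicVol φ k Γ) →
      L = PhiVolume.mixedVol φ) := by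
  refine ⟨PhiVolume.mixedVol_eq_polarization φ hk, PhiVolume.isSymmetric_mixedVol φ k,
    PhiVolume.isKLinear_mixedVol φ k, PhiVolume.mixedVol_diagonal φ, fun L hs hL hd => ?_⟩
  funext Γ
  have hfac : (k.factorial : ℝ) ≠ 0 := by exact_mod_cast k.factorial_ne_zero
  -- Both `L` and the mixed φ-volume equal the polarization of the same diagonal function.
  have h := PhiVolume.altSum_diagonal_of_isKLinear hs hL Γ
  simp only [hd] at h
  rw [PhiVolume.mixedVol_eq_altSum, h, mul_div_cancel_left₀ _ hfac]
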